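/- Let $d\ge 1$, let $\Lambda$ be a stationary random Borel measure on $\mathbb{R}^d$ with $\mathbb{E}[\Lambda([0,1]^d)]=1$, and for $\lambda>0$ let $X^\lambda$ be a Cox point process with random intensity measure $\lambda\Lambda$, i.e. conditioned on $\Lambda$, $X^\lambda$ is a Poisson point process with intensity measure $\lambda\Lambda$. Write $Q_s=[-s/2,s/2]^d$, and $\vartheta_x\mu(B)=\mu(B+x)$ for measures $\mu$. The Palm versions $\Lambda^*$ and $X^{\lambda,*}$ are the random measure and the point process with laws $$\mathbb{E}[f(\Lambda^*)]=\mathbb{E}\Big[\int_{Q_1}f(\vartheta_x\Lambda)\,\Lambda(\mathrm{d}x)\Big],\qquad \mathbb{E}[f(X^{\lambda,*})]=\frac1\lambda\,\mathbb{E}\Big[\sum_{X_i\in X^\lambda\cap Q_1}f(X^\lambda-X_i)\Big]$$ for bounded measurable $f\ge 0$. For $r>0$ let $\theta(\lambda,r)$ be the probability that the origin $o$ lies in an infinite connected component of the Gilbert graph $g_r(X^{\lambda,*})$, in which two points of $X^{\lambda,*}$ are joined by an edge if their distance is less than $r$. Let $\mathcal{R}_r$ be the family of all compact sets $A\subset\mathbb{R}^d$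 with $o\in A$ such that the set of points at distance at most $r/2$ from $A$ is connected, and let $\partial_rA=\{x\in\mathbb{R}^d:\operatorname{dist}(x,A)<r\}\setminus A$. **Theorem.** Let $r>0$. Then $$\liminf_{\lambda\uparrow\infty}\lambda^{-1}\log(1-\theta(\lambda,r))\ \ge\ -\inf_{A\in\mathcal{R}_r}\operatorname{ess\,inf}\Lambda^*(\partial_rA).$$ If, additionally, $d\ge 2$, $\Lambda$ is $b$-dependent for some $b\ge0$ (that is, the restrictions of $\Lambda$ to Borel sets $A$ and $B$ are independent whenever $\operatorname{dist}(A,B)>b$), and $\operatorname{ess\,inf}\Lambda(Q_\delta)>0$ for every $\delta>0$, then the limit on the right-hand side below exists in $[0,\infty]$ and $$\limsup_{\lambda\uparrow\infty}\lambda^{-1}\log(1-\theta(\lambda,r))\ \le\ -\lim_{\varepsilon\downarrow0}\ \inf_{A\in\mathcal{R}_{r+\varepsilon}}\operatorname{ess\,inf}\Lambda^*(\partial_{r-\varepsilon}A).$$ -/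

import Mathlib

open MeasureTheory ProbabilityTheory Filter Topology
open scoped ENNReal NNReal

noncomputable section

namespace CoxPerc

/-- The Euclidean space `ℝ^d`. -/
abbrev Space (d : ℕ) : Type := EuclideanSpace ℝ (Fin d)

/-- The closed cube `Q_s(x) = x + [-s/2, s/2]^d`. -/
def cube {d : ℕ} (s : ℝ) (x : Space d) : Set (Space d) :=
  {y | ∀ i, |y i - x i| ≤ s / 2}

/-- The unit cube `[0,1]^d`. -/
def unitCube (d : ℕ) : Set (Space d) :=
  {y | ∀ i, 0 ≤ y i ∧ y i ≤ 1}

/-- The translation `ϑ_x μ`, that is `(ϑ_x μ)(A) = μ(A + x)`.  A counting measure with points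
`X_j` is sent to the counting measure with points `X_j - x`. -/
def shift {d : ℕ} (x : Space d) (μ : Measure (Space d)) : Measure (Space d) :=
  μ.map (fun y => y - x)

/-- A random measure (on the probability space `(Ω, P)`) is stationary if its law, on the space of
Borel measures with the evaluation `σ`-algebra, is invariant under all translations. -/
def IsStationary {d : ℕ} {Ω : Type*} [MeasurableSpace Ω] (P : Measure Ω)
    (M : Ω → Measure (Space d)) : Prop :=
  ∀ x : Space d, P.map (fun ω => shift x (M ω)) = P.map M

/-- `b`-dependence: the restrictions of the random measure to Borel sets `A` and `B` are
independent whenever `dist(A, B) = inf {|x - y| : x ∈ A, y ∈ B} > b`. -/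
def IsBDependent {d : ℕ} {Ω : Type*} [MeasurableSpace Ω] (P : Measure Ω)
    (M : Ω → Measure (Space d)) (b : ℝ≥0) : Prop :=
  ∀ A B : Set (Space d), MeasurableSet A → MeasurableSet B →
    (b : ℝ≥0∞) < (⨅ x ∈ A, ⨅ y ∈ B, edist x y) →
    IndepFun (fun ω => (M ω).restrict A) (fun ω => (M ω).restrict B) P

/-- The Poisson distribution on `{0, 1, 2, …} ∪ {∞}` with parameter `t ∈ [0, ∞]`; for `t = ∞` it
is the unit mass at `∞`. -/
def poissonLaw (t : ℝ≥0∞) : Measure ℝ≥0∞ :=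
  if t = ∞ then Measure.dirac ∞
  else (poissonMeasure t.toNNReal).map (fun n : ℕ => (n : ℝ≥0∞))

/-- `Q` is the law of a Poisson point process with intensity measure `μ`: it is concentrated on
counting measures, the number of points in a Borel set `B` is Poisson distributed with parameter
`μ(B)`, and the numbers of points in pairwise disjoint Borel sets are independent. -/
structure IsPoissonProcess {d : ℕ} (μ : Measure (Space d)) (Q : Measure (Measure (Space d))) :
    Prop where
  isProbabilityMeasure : IsProbabilityMeasure Q
  counting : ∀ᵐ N ∂Q, ∀ B : Set (Space d), MeasurableSet B → ∃ n : ℕ∞, N B = (n : ℝ≥0∞)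
  map_count : ∀ B : Set (Space d), MeasurableSet B → Q.map (fun N => N B) = poissonLaw (μ B)
  indep : ∀ (n : ℕ) (B : Fin n → Set (Space d)), (∀ i, MeasurableSet (B i)) →
    Pairwise (fun i j => Disjoint (B i) (B j)) →
    iIndepFun (fun i (N : Measure (Space d)) => N (B i)) Q

/-- `X` is a Cox point process with random intensity measure `M`: there is a regular conditional
law `κ` of `X` given `M`, and conditioned on `M` the process `X` is a Poisson point process with
intensity measure `M`. -/
structure IsCoxProcess {d : ℕ} {Ω : Type*} [MeasurableSpace Ω] (P : Measure Ω)
    (M X : Ω → Measure (Space d)) : Prop where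
  measurable : Measurable X
  conditional : ∃ κ : Kernel (Measure (Space d)) (Measure (Space d)), IsMarkovKernel κ ∧
    P.map (fun ω => (M ω, X ω)) = (P.map M) ⊗ₘ κ ∧
    ∀ᵐ μ ∂(P.map M), IsPoissonProcess μ (κ μ)

/-- The (unnormalized) Palm measure of a random measure `M`: the measure on the space of Borel
measures with `∫ f d(palm) = E [∫_{Q_1} f(ϑ_x M) M(dx)]`.  If `M` is a point process, then the
right-hand side is `E [∑_{X_i ∈ Q_1} f(M - X_i)]`. If `E [M(Q_1)] = 1`, this is the law of the
Palm version `M^*`. -/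
def palm {d : ℕ} {Ω : Type*} [MeasurableSpace Ω] (P : Measure Ω)
    (M : Ω → Measure (Space d)) : Measure (Measure (Space d)) :=
  P.bind (fun ω => ((M ω).restrict (cube 1 0)).map (fun x => shift x (M ω)))

/-- The set of points of a counting measure. -/
def points {d : ℕ} (N : Measure (Space d)) : Set (Space d) :=
  {x | N {x} ≠ 0}

/-- The Gilbert graph on the vertex set `V`: two distinct points are connected by an edge if their
distance is less than `r`. -/
def gilbertGraph {d : ℕ} (r : ℝ) (V : Set (Space d)) : SimpleGraph V where
  Adj x y := x ≠ y ∧ dist x y < r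
  symm := ⟨fun x y h => ⟨h.1.symm, by rw [dist_comm]; exact h.2⟩⟩
  loopless := ⟨fun _ h => h.1 rfl⟩

/-- The event `o ↭ ∞`: the origin is a point of `N` and its connected component in the Gilbert
graph on the points of `N` is infinite. -/
def OriginPercolates {d : ℕ} (r : ℝ) (N : Measure (Space d)) : Prop :=
  ∃ h : (0 : Space d) ∈ points N,
    ((gilbertGraph r (points N)).connectedComponentMk ⟨0, h⟩).supp.Infinite

/-- The percolation probability `P(o ↭ ∞ in g_r(X^*))`, where `X` is a stationary point process
with intensity `lam` (so `E [X(Q_1)] = lam`) and `X^*` is its Palm version, whose law is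
`lam⁻¹ • palm P X`. -/
def percProb {d : ℕ} {Ω : Type*} [MeasurableSpace Ω] (P : Measure Ω)
    (X : Ω → Measure (Space d)) (lam r : ℝ) : ℝ≥0∞ :=
  ((ENNReal.ofReal lam)⁻¹ • palm P X) {N | OriginPercolates r N}

/-- The family `R_r` of `r`-connected compact sets containing the origin: the points at distance
at most `r / 2` from `A` form a connected set. -/
def rConnected (d : ℕ) (r : ℝ) : Set (Set (Space d)) :=
  {A | IsCompact A ∧ 0 ∈ A ∧ IsConnected (Metric.cthickening (r / 2) A)}

/-- The `r`-boundary `∂_r A = {x : dist(x, A) < r} \ A`. -/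
def rBoundary {d : ℕ} (r : ℝ) (A : Set (Space d)) : Set (Space d) :=
  Metric.thickening r A \ A

/-- The quantity `inf_{A ∈ R_s} ess-inf Λ^*(∂_t A)` in `[0, ∞]`. -/
def isolationCost {d : ℕ} {Ω : Type*} [MeasurableSpace Ω] (P : Measure Ω)
    (Lam : Ω → Measure (Space d)) (s t : ℝ) : ℝ≥0∞ :=
  ⨅ A ∈ rConnected d s, essInf (fun μ : Measure (Space d) => μ (rBoundary t A)) (palm P Lam)

end CoxPerc

end

noncomputable section

namespace CoxPerc

/-! Everything rests on one formula, `palmLaw_void`: for open `S` missing the origin, the Palm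
version of the Cox process has no point in `S` with probability `E[exp(-λ Λ*(S))]`. It comes from a
Mecke identity proved only for void events, where both Campbell-type measures can be computed on a
π-system of rectangles.

Lower bound. If the shell `∂_r A` of a compact `A` containing the origin is empty, no edge leaves
`A`, so the component of the origin is finite (`not_originPercolates`). Hence `1 - θ ≥ E[exp(-λ
Λ*(∂_r A))]`. For any `K` above the essential infimum of `Λ*(∂_r A)`, the event `Λ*(∂_r A) < K` has
positive probability, which gives the rate `-K`; then `A` is optimised.

Upper bound. Suppose the cluster of the origin is finite, and cut space into cubes of small side
`δ`. Either the cluster stays in a fixed box, or it reaches far. In the first case it is replaced by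
the union of the cubes that it visits. This is an `r`-connected compact set whose `(r - ε)`-shell is
empty once `√d δ ≤ ε`; there are finitely many such unions in the box, so a union bound costs only a
constant factor. In the second case the cubes near the cluster form a connected set of lattice
sites, whose outer boundary contains a long self-avoiding path of empty cubes
(`exists_boundary_path`). Under the Palm law every cube has mass at least some `c > 0`, so a Peierls
count bounds this case by a constant times `exp(-λ c n)`, with `n` at the scale of the box. Taking
`n` large makes this negligible at any prescribed rate.

The topological input is that the part of the boundary of a connected set seen from one
complementary component is connected (`kingConn_visibleBoundary`). It follows from the vanishing of
the first cohomology of `ℤ^d` modulo two (`exists_potential`). -/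

/-! ### Lattice topology: outer boundaries of connected sets of sites. -/

/-- Two sites of `ℤ^d` are neighbours if they are at sup-distance at most one. -/
def KingAdj {d : ℕ} (x y : Fin d → ℤ) : Prop := ∀ i, |x i - y i| ≤ 1

/-- `x` and `y` are joined by a chain of neighbouring sites in `S`. -/
def KingConn {d : ℕ} (S : Set (Fin d → ℤ)) : (Fin d → ℤ) → (Fin d → ℤ) → Prop :=
  Relation.ReflTransGen fun a b => KingAdj a b ∧ a ∈ S ∧ b ∈ S

theorem KingAdj.symm {d : ℕ} {x y : Fin d → ℤ} (h : KingAdj x y) : KingAdj y x :=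
  fun i => by rw [abs_sub_comm]; exact h i

theorem KingAdj.refl {d : ℕ} (x : Fin d → ℤ) : KingAdj x x := fun i => by simp

theorem KingConn.symm {d : ℕ} {S : Set (Fin d → ℤ)} {x y : Fin d → ℤ} (h : KingConn S x y) :
    KingConn S y x := by
  induction h with
  | refl => exact Relation.ReflTransGen.refl
  | tail _ h ih => exact Relation.ReflTransGen.head ⟨h.1.symm, h.2.2, h.2.1⟩ ih

theorem KingConn.mono {d : ℕ} {S T : Set (Fin d → ℤ)} (hST : S ⊆ T) {x y : Fin d → ℤ}
    (h : KingConn S x y) : KingConn T x y :=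
  Relation.ReflTransGen.mono (fun _ _ h => ⟨h.1, hST h.2.1, hST h.2.2⟩) x y h

theorem KingConn.mem {d : ℕ} {S : Set (Fin d → ℤ)} {x y : Fin d → ℤ} (h : KingConn S x y)
    (hy : y ∈ S) : x ∈ S := by
  induction h using Relation.ReflTransGen.head_induction_on with
  | refl => exact hy
  | head h _ _ => exact h.2.1

theorem KingConn.component {d : ℕ} {S : Set (Fin d → ℤ)} {x y : Fin d → ℤ} (h : KingConn S x y) :
    KingConn {z | KingConn S z y} x y := by
  induction h using Relation.ReflTransGen.head_induction_on with
  | refl => exact Relation.ReflTransGen.refl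
  | head h h' ih => exact Relation.ReflTransGen.head ⟨h.1, Relation.ReflTransGen.head h h', h'⟩ ih

/-- One step of the contraction of `ℤ` to the origin. -/
def towardsZero (a : ℤ) : ℤ := a - a.sign

theorem towardsZero_cases (a : ℤ) :
    (0 < a ∧ towardsZero a = a - 1) ∨ (a = 0 ∧ towardsZero a = 0) ∨
      (a < 0 ∧ towardsZero a = a + 1) := by
  unfold towardsZero
  rcases lt_trichotomy a 0 with h | h | h
  · right; right; exact ⟨h, by rw [Int.sign_eq_neg_one_of_neg h]; ring⟩
  · right; left; subst h; simp
  · left; exact ⟨h, by rw [Int.sign_eq_one_of_pos h]⟩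

/-- One step of the contraction of `ℤ^d` to the origin. -/
def contract {d : ℕ} (x : Fin d → ℤ) : Fin d → ℤ := fun i => towardsZero (x i)

theorem iterate_contract {d : ℕ} (n : ℕ) :
    ∀ x : Fin d → ℤ, (∀ i, |x i| ≤ n) → contract^[n] x = 0 := by
  induction n with
  | zero =>
    intro x hx
    funext i
    have := hx i
    simpa using this
  | succ n ih =>
    intro x hx
    rw [Function.iterate_succ_apply]
    refine ih _ fun i => ?_
    have h1 := hx i
    have h2 := towardsZero_cases (x i)
    simp only [contract]
    rw [abs_le] at *
    push_cast at h1
    omega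

/-- In each coordinate the four values lie in an interval of length at most two, so its middle is
within one of all of them. The site found is the apex from which the square of one contraction step
is filled by triangles. -/
theorem exists_common_neighbour {d : ℕ} {x y : Fin d → ℤ} (h : KingAdj x y) :
    ∃ w, KingAdj w x ∧ KingAdj w y ∧ KingAdj w (contract x) ∧ KingAdj w (contract y) := by
  have key : ∀ i, ∃ w : ℤ, |w - x i| ≤ 1 ∧ |w - y i| ≤ 1 ∧ |w - towardsZero (x i)| ≤ 1 ∧
      |w - towardsZero (y i)| ≤ 1 := by
    intro i
    have h0 := h i
    have h1 := towardsZero_cases (x i)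
    have h2 := towardsZero_cases (y i)
    simp only [abs_le] at *
    by_cases hc : 0 < x i ∨ 0 < y i
    · exact ⟨max (x i) (y i) - 1, by omega⟩
    · exact ⟨min (x i) (y i) + (if x i = 0 ∧ y i = 0 then 0 else 1), by split_ifs <;> omega⟩
  choose w hw using key
  exact ⟨w, fun i => (hw i).1, fun i => (hw i).2.1, fun i => (hw i).2.2.1, fun i => (hw i).2.2.2⟩

theorem kingAdj_contract {d : ℕ} (x : Fin d → ℤ) : KingAdj x (contract x) := by
  intro i
  have h1 := towardsZero_cases (x i)
  simp only [contract, abs_le]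
  omega

theorem KingAdj.contract {d : ℕ} {x y : Fin d → ℤ} (h : KingAdj x y) :
    KingAdj (contract x) (contract y) := by
  intro i
  have h0 := h i
  have h1 := towardsZero_cases (x i)
  have h2 := towardsZero_cases (y i)
  simp only [CoxPerc.contract, abs_le] at *
  omega

/-- The discrete Poincaré lemma modulo two: a function of pairs of neighbouring sites which is
closed on triangles is exact. -/
theorem exists_potential {d : ℕ} (ω : (Fin d → ℤ) → (Fin d → ℤ) → ZMod 2)
    (hω : ∀ x y z, KingAdj x y → KingAdj y z → KingAdj x z → ω x y + ω y z + ω x z = 0) :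
    ∃ f : (Fin d → ℤ) → ZMod 2, ∀ x y, KingAdj x y → f x + f y = ω x y := by
  have two : ∀ a : ZMod 2, a + a = 0 := fun a => CharTwo.add_self_eq_zero a
  have hxx : ∀ x, ω x x = 0 := by
    intro x
    have := hω x x x (KingAdj.refl x) (KingAdj.refl x) (KingAdj.refl x)
    rwa [two, zero_add] at this
  have hsymm : ∀ x y, KingAdj x y → ω x y = ω y x := by
    intro x y h
    have := hω x y x h h.symm (KingAdj.refl x)
    rw [hxx, add_zero] at this
    exact CharTwo.add_eq_zero.mp this
  -- The square with corners `x`, `y` and their contractions is coned off from a common neighbour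
  -- `w`; in the sum of the four triangle relations every spoke from `w` occurs twice and cancels.
  have square : ∀ x y, KingAdj x y →
      ω x y + ω (contract x) (contract y) = ω x (contract x) + ω y (contract y) := by
    intro x y h
    obtain ⟨w, h1, h2, h3, h4⟩ := exists_common_neighbour h
    have e1 := hω w x y h1 h h2
    have e2 := hω w (contract x) (contract y) h3 h.contract h4
    have e3 := hω w x (contract x) h1 (kingAdj_contract x) h3
    have e4 := hω w y (contract y) h2 (kingAdj_contract y) h4
    generalize ω x y = a at *
    generalize ω (contract x) (contract y) = b at *
    generalize ω x (contract x) = c at *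
    generalize ω y (contract y) = e at *
    generalize ω w x = p at *
    generalize ω w y = q at *
    generalize ω w (contract x) = s at *
    generalize ω w (contract y) = t at *
    revert a b c e p q s t
    decide
  have tele : ∀ (n : ℕ) (x y), KingAdj x y →
      (∑ k ∈ Finset.range n, ω (contract^[k] x) (contract^[k + 1] x)) +
        ∑ k ∈ Finset.range n, ω (contract^[k] y) (contract^[k + 1] y) =
      ω x y + ω (contract^[n] x) (contract^[n] y) ∧ KingAdj (contract^[n] x) (contract^[n] y) := by
    intro n x y h
    induction n with
    | zero => simp [two, h]
    | succ n ih =>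
      obtain ⟨ih1, ih2⟩ := ih
      refine ⟨?_, by simpa only [Function.iterate_succ_apply'] using ih2.contract⟩
      rw [Finset.sum_range_succ, Finset.sum_range_succ, add_add_add_comm, ih1]
      have := square _ _ ih2
      simp only [Function.iterate_succ_apply'] at *
      rw [← this, ← add_assoc, add_assoc (ω x y), two, add_zero]
  -- The orbit of `x` under contraction is constantly `0` after `N x` steps, so the sum of `ω` along
  -- it is finite. This sum is the potential.
  let N : (Fin d → ℤ) → ℕ := fun x => ∑ i, (x i).natAbs
  have hN : ∀ x i, |x i| ≤ (N x : ℤ) := by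
    intro x i
    rw [Int.abs_eq_natAbs]
    exact_mod_cast Finset.single_le_sum (f := fun i => (x i).natAbs) (fun _ _ => Nat.zero_le _)
      (Finset.mem_univ i)
  have stable : ∀ x n, N x ≤ n →
      ∑ k ∈ Finset.range n, ω (contract^[k] x) (contract^[k + 1] x) =
        ∑ k ∈ Finset.range (N x), ω (contract^[k] x) (contract^[k + 1] x) := by
    intro x n hn
    symm
    refine Finset.sum_subset (Finset.range_mono hn) fun k _ hk => ?_
    have hk' : N x ≤ k := by simpa using hk
    rw [iterate_contract k x fun i => (hN x i).trans (by exact_mod_cast hk'),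
      iterate_contract (k + 1) x fun i => (hN x i).trans (by exact_mod_cast hk'.trans k.le_succ),
      hxx]
  refine ⟨fun x => ∑ k ∈ Finset.range (N x), ω (contract^[k] x) (contract^[k + 1] x), ?_⟩
  intro x y h
  have h1 := (tele (max (N x) (N y)) x y h).1
  rw [stable x _ (le_max_left _ _), stable y _ (le_max_right _ _),
    iterate_contract _ x fun i => (hN x i).trans (by exact_mod_cast le_max_left _ _),
    iterate_contract _ y fun i => (hN y i).trans (by exact_mod_cast le_max_right _ _),
    hxx, add_zero] at h1
  exact h1

/-- Here `a, b, c` stand for membership of the three vertices in `C`, and `p, q, s` for membership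
in `V`. If one edge joins `C` to `V`, the third vertex lies in `C` or in `V`, so exactly two edges
do: the edge indicator is closed. -/
theorem triangle_parity {a b c p q s : Prop} [Decidable a] [Decidable b] [Decidable c]
    [Decidable p] [Decidable q] [Decidable s] (a1 : p → ¬a) (a2 : q → ¬b) (a3 : s → ¬c)
    (b1 : a → q → c ∨ s) (b2 : a → s → b ∨ q) (b3 : b → p → c ∨ s) (b4 : b → s → a ∨ p)
    (b5 : c → p → b ∨ q) (b6 : c → q → a ∨ p) :
    (if (a ∧ q) ∨ (b ∧ p) then (1 : ZMod 2) else 0) + (if (b ∧ s) ∨ (c ∧ q) then 1 else 0) +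
      (if (a ∧ s) ∨ (c ∧ p) then 1 else 0) = 0 := by
  split_ifs <;> first | decide | (exfalso; grind)

/-- The sites of `D` that are neighbours of `C`. -/
def visibleBoundary {d : ℕ} (C D : Set (Fin d → ℤ)) : Set (Fin d → ℤ) :=
  {v | v ∈ D ∧ ∃ c ∈ C, KingAdj c v}

/-- The boundary of a connected set that is visible from a component of the complement is
connected. -/
theorem kingConn_visibleBoundary {d : ℕ} {C D : Set (Fin d → ℤ)}
    (hC : ∀ x ∈ C, ∀ y ∈ C, KingConn C x y) (hD : ∀ x ∈ D, ∀ y ∈ D, KingConn D x y)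
    (hCD : Disjoint C D) (hcl : ∀ x ∈ D, ∀ y, y ∉ C → KingAdj x y → y ∈ D)
    {u v : Fin d → ℤ} (hu : u ∈ visibleBoundary C D) (hv : v ∈ visibleBoundary C D) :
    KingConn (visibleBoundary C D) u v := by
  classical
  by_contra huv
  set B := visibleBoundary C D with hB
  set V : Set (Fin d → ℤ) := {w | w ∈ B ∧ KingConn B u w} with hV
  have hVC : ∀ x, x ∈ V → x ∉ C := fun x hx hxC => Set.disjoint_left.mp hCD hxC hx.1.1
  have hthird : ∀ c ∈ C, ∀ w ∈ V, ∀ o, KingAdj c o → KingAdj w o → o ∈ C ∨ o ∈ V := by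
    intro c hc w hw o hco hwo
    by_cases ho : o ∈ C
    · exact Or.inl ho
    · have hoB : o ∈ B := ⟨hcl w hw.1.1 o ho hwo, c, hc, hco⟩
      exact Or.inr ⟨hoB, hw.2.tail ⟨hwo, hw.1, hoB⟩⟩
  -- The cocycle marks the edges between `C` and the boundary component `V` of `u`. No marked edge
  -- lies inside `C` or inside `D`, so its potential is constant on each of them. But an edge from
  -- `C` to `u` is marked and an edge from `C` to `v` is not, a contradiction.
  obtain ⟨f, hf⟩ := exists_potential
    (fun x y => if (x ∈ C ∧ y ∈ V) ∨ (y ∈ C ∧ x ∈ V) then (1 : ZMod 2) else 0) (by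
    intro x y z hxy hyz hxz
    have a1 := hVC x
    have a2 := hVC y
    have a3 := hVC z
    have b1 : x ∈ C → y ∈ V → z ∈ C ∨ z ∈ V := fun h h' => hthird x h y h' z hxz hyz
    have b2 : x ∈ C → z ∈ V → y ∈ C ∨ y ∈ V := fun h h' => hthird x h z h' y hxy hyz.symm
    have b3 : y ∈ C → x ∈ V → z ∈ C ∨ z ∈ V := fun h h' => hthird y h x h' z hyz hxz
    have b4 : y ∈ C → z ∈ V → x ∈ C ∨ x ∈ V :=
      fun h h' => hthird y h z h' x hxy.symm hxz.symm
    have b5 : z ∈ C → x ∈ V → y ∈ C ∨ y ∈ V := fun h h' => hthird z h x h' y hyz.symm hxy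
    have b6 : z ∈ C → y ∈ V → x ∈ C ∨ x ∈ V :=
      fun h h' => hthird z h y h' x hxz.symm hxy.symm
    exact triangle_parity a1 a2 a3 b1 b2 b3 b4 b5 b6)
  have hconst : ∀ S : Set (Fin d → ℤ), (∀ a ∈ S, ∀ b ∈ S, ¬(a ∈ C ∧ b ∈ V)) →
      ∀ a b, KingConn S a b → f a = f b := by
    intro S hS a b hab
    induction hab with
    | refl => rfl
    | tail _ h ih =>
      rw [ih]
      have := hf _ _ h.1
      rw [if_neg (by
        rintro (h' | h')
        · exact hS _ h.2.1 _ h.2.2 h'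
        · exact hS _ h.2.2 _ h.2.1 h')] at this
      exact CharTwo.add_eq_zero.mp this
  obtain ⟨huD, c₁, hc₁, h₁⟩ := hu
  obtain ⟨hvD, c₂, hc₂, h₂⟩ := hv
  have e1 := hconst C (fun a _ b hb h => hVC b h.2 hb) c₁ c₂ (hC _ hc₁ _ hc₂)
  have e2 := hconst D (fun a ha b _ h => Set.disjoint_left.mp hCD h.1 ha) u v (hD _ huD _ hvD)
  have huV : u ∈ V := ⟨⟨huD, c₁, hc₁, h₁⟩, Relation.ReflTransGen.refl⟩
  have hvV : v ∉ V := fun h => huv h.2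
  have e3 := hf _ _ h₁
  have e4 := hf _ _ h₂
  rw [if_pos (Or.inl ⟨hc₁, huV⟩)] at e3
  rw [if_neg (by
    rintro (h' | h')
    · exact hvV h'.2
    · exact Set.disjoint_left.mp hCD h'.1 hvD)] at e4
  rw [e1, e2, e4] at e3
  exact absurd e3 (by decide)

theorem kingConn_of_convex {d : ℕ} (n : ℕ) (y : Fin d → ℤ) :
    ∀ x : Fin d → ℤ, (∀ i, |x i - y i| ≤ n) →
      KingConn {z | ∀ i, min (x i) (y i) ≤ z i ∧ z i ≤ max (x i) (y i)} x y := by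
  induction n with
  | zero =>
    intro x hx
    have : x = y := by
      funext i
      have := hx i
      simp only [Nat.cast_zero, abs_le] at this
      omega
    subst this
    exact Relation.ReflTransGen.refl
  | succ n ih =>
    intro x hx
    have hs : ∀ i, (x i < y i ∧ x i + (y i - x i).sign = x i + 1) ∨
        (x i = y i ∧ x i + (y i - x i).sign = x i) ∨
        (y i < x i ∧ x i + (y i - x i).sign = x i - 1) := by
      intro i
      rcases lt_trichotomy (x i) (y i) with h | h | h
      · left; exact ⟨h, by rw [Int.sign_eq_one_of_pos (by omega)]⟩
      · right; left; exact ⟨h, by rw [h]; simp⟩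
      · right; right; exact ⟨h, by rw [Int.sign_eq_neg_one_of_neg (by omega)]; ring⟩
    set w : Fin d → ℤ := fun i => x i + (y i - x i).sign with hw
    have hs' : ∀ i, (x i < y i ∧ w i = x i + 1) ∨ (x i = y i ∧ w i = x i) ∨
        (y i < x i ∧ w i = x i - 1) := hs
    refine Relation.ReflTransGen.head (b := w) ⟨fun i => ?_, fun i => by simp, fun i => ?_⟩
      (KingConn.mono ?_ (ih w fun i => ?_))
    · have := hs' i
      rw [abs_le]; omega
    · have := hs' i
      omega
    · intro z hz i
      have := hs' i
      have := hz i
      omega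
    · have := hs' i
      have := hx i
      rw [abs_le] at *
      push_cast at *
      omega

theorem kingConn_box {d : ℕ} (x y : Fin d → ℤ) :
    KingConn {z | ∀ i, min (x i) (y i) ≤ z i ∧ z i ≤ max (x i) (y i)} x y := by
  refine kingConn_of_convex (∑ i, (x i - y i).natAbs) y x fun i => ?_
  rw [Int.abs_eq_natAbs]
  exact_mod_cast Finset.single_le_sum (f := fun i => (x i - y i).natAbs)
    (fun _ _ => Nat.zero_le _) (Finset.mem_univ i)

/-- In dimension at least two the complement of a box is connected. -/
theorem kingConn_far {d : ℕ} (hd : 2 ≤ d) (R : ℤ) (x : Fin d → ℤ) (i : Fin d) (hx : R ≤ |x i|) :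
    KingConn {z | ∃ j, R ≤ |z j|} x (fun _ => R) := by
  obtain ⟨j, hj⟩ : ∃ j : Fin d, j ≠ i := by
    have : Nontrivial (Fin d) := Fin.nontrivial_iff_two_le.mpr hd
    exact exists_ne i
  have h1 := kingConn_box x (Function.update (fun _ => R) i (x i))
  have h2 := kingConn_box (Function.update (fun _ => R) i (x i)) (fun _ => R)
  -- First coordinate `i` is frozen at its large value while the others move to `R`; then coordinate
  -- `j` stays at `R` while coordinate `i` moves. This needs two coordinates.
  refine Relation.ReflTransGen.trans (h1.mono ?_) (h2.mono ?_)
  · intro z hz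
    have := hz i
    simp only [Function.update_self, min_self, max_self] at this
    exact ⟨i, by rw [le_antisymm this.2 this.1]; exact hx⟩
  · intro z hz
    have := hz j
    rw [Function.update_of_ne hj] at this
    simp only [min_self, max_self] at this
    exact ⟨j, by rw [le_antisymm this.2 this.1]; exact le_abs_self R⟩

/-- A step changes coordinate `i` by at most one, so a self-avoiding path from `u` to `v` has at
least `m` steps. -/
theorem exists_path_of_kingConn {d : ℕ} {S : Set (Fin d → ℤ)} {u v : Fin d → ℤ}
    (h : KingConn S u v) (hu : u ∈ S) (m : ℕ) (i : Fin d) (hm : (m : ℤ) ≤ |u i - v i|) :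
    ∃ p : ℕ → Fin d → ℤ, p 0 = u ∧ (∀ j, p j ∈ S) ∧ (∀ j, KingAdj (p j) (p (j + 1))) ∧
      Set.InjOn p (Set.Iic m) := by
  classical
  let G : SimpleGraph (Fin d → ℤ) :=
    { Adj := fun a b => a ≠ b ∧ KingAdj a b ∧ a ∈ S ∧ b ∈ S
      symm := ⟨fun _ _ h => ⟨h.1.symm, h.2.1.symm, h.2.2.2, h.2.2.1⟩⟩
      loopless := ⟨fun _ h => h.1 rfl⟩ }
  have hreach : ∀ v, KingConn S u v → G.Reachable u v := by
    intro v h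
    induction h with
    | refl => exact SimpleGraph.Reachable.refl _
    | @tail b c _ hbc ih =>
      by_cases hne : b = c
      · exact hne ▸ ih
      · exact ih.trans (SimpleGraph.Adj.reachable ⟨hne, hbc⟩)
  obtain ⟨w, hw⟩ := (hreach v h).exists_isPath
  have hdist : ∀ {a b : Fin d → ℤ} (q : G.Walk a b), |a i - b i| ≤ q.length := by
    intro a b q
    induction q with
    | nil => simp
    | cons h q ih =>
      have := h.2.1 i
      rw [SimpleGraph.Walk.length_cons]
      push_cast
      rw [abs_le] at *
      omega
  have hlen : m ≤ w.length := by exact_mod_cast hm.trans (hdist w)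
  -- Past its end the walk rests at its last vertex; adjacency includes equality, and injectivity is
  -- asked only up to `m`.
  refine ⟨w.getVert, w.getVert_zero, fun j => ?_, fun j => ?_, ?_⟩
  · induction j with
    | zero => simpa using hu
    | succ j ih =>
      by_cases hj : j < w.length
      · exact (w.adj_getVert_succ hj).2.2.2
      · rw [w.getVert_of_length_le (by omega)]
        rwa [w.getVert_of_length_le (by omega)] at ih
  · by_cases hj : j < w.length
    · exact (w.adj_getVert_succ hj).2.1
    · rw [w.getVert_of_length_le (by omega), w.getVert_of_length_le (by omega)]
      exact KingAdj.refl _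
  · exact hw.getVert_injOn.mono fun j hj => le_trans hj hlen

/-- The site `c` moved by `m` in direction `i`. -/
def shiftSite {d : ℕ} (i : Fin d) (m : ℤ) (c : Fin d → ℤ) : Fin d → ℤ :=
  Function.update c i (c i + m)

theorem shiftSite_self {d : ℕ} (i : Fin d) (m : ℤ) (c : Fin d → ℤ) :
    shiftSite i m c i = c i + m := by simp [shiftSite]

theorem shiftSite_zero {d : ℕ} (i : Fin d) (c : Fin d → ℤ) : shiftSite i 0 c = c := by
  simp [shiftSite]

theorem kingAdj_shiftSite {d : ℕ} (c : Fin d → ℤ) (i : Fin d) {m n : ℤ} (h : |m - n| ≤ 1) :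
    KingAdj (shiftSite i m c) (shiftSite i n c) := by
  intro j
  by_cases hj : j = i
  · subst hj
    rwa [shiftSite_self, shiftSite_self, add_sub_add_left_eq_sub]
  · simp [shiftSite, hj]

/-- A finite connected set of sites that contains the origin and a site at distance at least `2 n`
is surrounded by a long path of sites of its outer boundary that starts close to the origin. -/
theorem exists_boundary_path {d : ℕ} (hd : 2 ≤ d) {C : Set (Fin d → ℤ)} (hfin : C.Finite)
    (hC : ∀ x ∈ C, ∀ y ∈ C, KingConn C x y) (h0 : 0 ∈ C) (n : ℕ)
    (hfar : ∃ z ∈ C, ∃ i, 2 * (n : ℤ) ≤ |z i|) :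
    ∃ k, n ≤ k ∧ ∃ a ≤ k, ∃ p : ℕ → Fin d → ℤ,
      p 0 = shiftSite ⟨0, by omega⟩ a 0 ∧ (∀ j, p j ∉ C ∧ ∃ c ∈ C, KingAdj c (p j)) ∧
      (∀ j, KingAdj (p j) (p (j + 1))) ∧ Set.InjOn p (Set.Iic k) := by
  classical
  obtain ⟨R, hR⟩ : ∃ R : ℤ, ∀ c ∈ C, ∀ i, |c i| < R := by
    obtain ⟨R, hR⟩ := (hfin.image fun c => ∑ i, |c i|).bddAbove
    refine ⟨R + 1, fun c hc i => Int.lt_add_one_of_le ?_⟩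
    exact (Finset.single_le_sum (f := fun i => |c i|) (fun _ _ => abs_nonneg _)
      (Finset.mem_univ i)).trans (hR ⟨c, hc, rfl⟩)
  have hsub : {z : Fin d → ℤ | ∃ j, R ≤ |z j|} ⊆ Cᶜ :=
    fun z ⟨j, hj⟩ hz => absurd (hR z hz j) (not_lt.mpr hj)
  set o : Fin d → ℤ := fun _ => R with ho
  have hoC : o ∈ Cᶜ := hsub ⟨⟨0, by omega⟩, le_abs_self R⟩
  -- The unbounded component of the complement, reached from a corner `o` outside a box containing
  -- `C`.
  set D : Set (Fin d → ℤ) := {x | KingConn Cᶜ x o} with hDdef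
  have hDC : ∀ x ∈ D, x ∉ C := fun x hx => KingConn.mem hx hoC
  have hcl : ∀ x ∈ D, ∀ y, y ∉ C → KingAdj x y → y ∈ D := fun x hx y hy hxy =>
    Relation.ReflTransGen.head ⟨hxy.symm, hy, hDC x hx⟩ hx
  have hDo : ∀ x ∈ D, KingConn D x o := fun x hx => KingConn.component hx
  have hDconn : ∀ x ∈ D, ∀ y ∈ D, KingConn D x y := fun x hx y hy =>
    Relation.ReflTransGen.trans (hDo x hx) (KingConn.symm (hDo y hy))
  have hCD : Disjoint C D := Set.disjoint_left.mpr fun x hx hxD => hDC x hxD hx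
  -- A ray from `C` along an axis ends in `D`. Where it passes from outside `D` into `D`, the
  -- previous site must be in `C`, since `D` absorbs its neighbours outside `C`.
  have ray : ∀ c ∈ C, ∀ i, ∀ s : ℤ, |s| = 1 →
      ∃ t : ℕ, shiftSite i (t * s) c ∈ visibleBoundary C D := by
    intro c hc i s hs
    have hex : ∃ t : ℕ, shiftSite i (t * s) c ∈ D := by
      refine ⟨(|c i| + |R|).toNat, KingConn.mono hsub (kingConn_far hd R _ i ?_)⟩
      rw [shiftSite_self, Int.toNat_of_nonneg (by positivity)]
      have h1 := abs_sub_abs_le_abs_sub ((|c i| + |R|) * s) (-(c i))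
      rw [abs_mul, hs, mul_one, abs_neg, abs_of_nonneg (by positivity : (0:ℤ) ≤ |c i| + |R|),
        sub_neg_eq_add, add_comm _ (c i)] at h1
      have := le_abs_self R
      linarith
    obtain ⟨t, hmin, hspec⟩ : ∃ t : ℕ, shiftSite i (t * s) c ∉ D ∧
        shiftSite i ((t + 1 : ℕ) * s) c ∈ D := by
      by_contra! hno
      obtain ⟨t, ht⟩ := hex
      refine absurd ht ?_
      clear ht
      induction t with
      | zero =>
        rw [Nat.cast_zero, zero_mul, shiftSite_zero]
        exact fun h => hDC c h hc
      | succ t ih => exact hno t ih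
    have hadj : KingAdj (shiftSite i (t * s) c) (shiftSite i ((t + 1 : ℕ) * s) c) := by
      refine kingAdj_shiftSite c i ?_
      have : (t : ℤ) * s - ((t + 1 : ℕ) : ℤ) * s = -s := by push_cast; ring
      rw [this, abs_neg, hs]
    exact ⟨t + 1, hspec, _, by_contra fun hn => hmin (hcl _ hspec _ hn hadj.symm), hadj⟩
  set i₀ : Fin d := ⟨0, by omega⟩ with hi₀
  obtain ⟨a, ha⟩ := ray 0 h0 i₀ 1 (by simp)
  obtain ⟨b, hb⟩ := ray 0 h0 i₀ (-1) (by simp)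
  rw [mul_one] at ha
  have hconn : ∀ v ∈ visibleBoundary C D, KingConn (visibleBoundary C D) (shiftSite i₀ a 0) v :=
    fun v hv => kingConn_visibleBoundary hC hDconn hCD hcl ha hv
  -- A second boundary site, `max n a` away from the first. If `n ≤ a`, it is found on the opposite
  -- half-axis. Otherwise coordinate `i` of the first site is at distance at least `n` either from
  -- the values beyond `z` or from those beyond `0`, and a ray from `z` or from `0` supplies the
  -- site. The length `max n a` keeps `a ≤ k`, which leaves only `k + 1` starting sites to count.
  have hq : ∃ v ∈ visibleBoundary C D, ∃ i,
      ((max n a : ℕ) : ℤ) ≤ |(shiftSite i₀ a 0) i - v i| := by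
    by_cases hna : n ≤ a
    · refine ⟨_, hb, i₀, ?_⟩
      simp only [shiftSite_self, Pi.zero_apply, max_eq_right hna]
      rw [le_abs]
      left
      have : (0 : ℤ) ≤ b := by positivity
      linarith
    · obtain ⟨z, hz, i, hi⟩ := hfar
      rw [max_eq_left (by omega)]
      set P : ℤ := (shiftSite i₀ a 0) i with hP
      rcases le_abs.mp hi with hi | hi
      · obtain ⟨t, ht⟩ := ray z hz i 1 (by simp)
        obtain ⟨t', ht'⟩ := ray 0 h0 i (-1) (by simp)
        by_cases hPn : P ≤ n
        · refine ⟨_, ht, i, ?_⟩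
          simp only [shiftSite_self]
          rw [le_abs]; right; linarith [(by positivity : (0 : ℤ) ≤ t)]
        · refine ⟨_, ht', i, ?_⟩
          simp only [shiftSite_self, Pi.zero_apply]
          rw [le_abs]; left; linarith [(by positivity : (0 : ℤ) ≤ t')]
      · obtain ⟨t, ht⟩ := ray z hz i (-1) (by simp)
        obtain ⟨t', ht'⟩ := ray 0 h0 i 1 (by simp)
        by_cases hPn : -n ≤ P
        · refine ⟨_, ht, i, ?_⟩
          simp only [shiftSite_self]
          rw [le_abs]; left; linarith [(by positivity : (0 : ℤ) ≤ t)]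
        · refine ⟨_, ht', i, ?_⟩
          simp only [shiftSite_self, Pi.zero_apply]
          rw [le_abs]; right; linarith [(by positivity : (0 : ℤ) ≤ t')]
  obtain ⟨v, hv, i, hi⟩ := hq
  obtain ⟨p, hp0, hpS, hpa, hpi⟩ := exists_path_of_kingConn (hconn v hv) ha (max n a) i hi
  exact ⟨max n a, le_max_left _ _, a, le_max_right _ _, p, hp0,
    fun j => ⟨hDC _ (hpS j).1, (hpS j).2⟩, hpa, hpi⟩

/-! ### Locally finite measures as an s-finite kernel, and measurability of shifts. -/

/-- The parameter space is sliced by the integer part of the total mass, and each slice is a finite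
kernel. S-finiteness is what makes integrals against a random measure measurable in that measure. -/
theorem isSFiniteKernel_of_forall_lt_top {α β : Type*} [MeasurableSpace α] [MeasurableSpace β]
    (κ : Kernel α β) (h : ∀ a, κ a Set.univ < ∞) : IsSFiniteKernel κ := by
  classical
  have hm : Measurable fun a => κ a Set.univ := κ.measurable_coe MeasurableSet.univ
  let s : ℕ → Set α := fun k => {a | (k : ℝ≥0∞) ≤ κ a Set.univ ∧ κ a Set.univ < (k + 1 : ℕ)}
  have hs : ∀ k, MeasurableSet (s k) := fun k =>
    (measurableSet_le measurable_const hm).inter (measurableSet_lt hm measurable_const)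
  have hfin : ∀ k, IsFiniteKernel (Kernel.piecewise (hs k) κ 0) := by
    intro k
    refine ⟨⟨(k + 1 : ℕ), ENNReal.natCast_lt_top _, fun a => ?_⟩⟩
    rw [Kernel.piecewise_apply]
    split_ifs with ha
    · exact ha.2.le
    · simp
  have hsum : κ = Kernel.sum fun k => Kernel.piecewise (hs k) κ 0 := by
    ext a B hB
    rw [Kernel.sum_apply' _ _ hB]
    obtain ⟨k, hk1, hk2⟩ : ∃ k : ℕ, (k : ℝ≥0∞) ≤ κ a Set.univ ∧ κ a Set.univ < (k + 1 : ℕ) := by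
      have hne := (h a).ne
      refine ⟨⌊(κ a Set.univ).toReal⌋₊, ?_, ?_⟩
      · rw [← ENNReal.ofReal_toReal hne, ← ENNReal.ofReal_natCast]
        exact ENNReal.ofReal_le_ofReal (by
          rw [ENNReal.toReal_ofReal ENNReal.toReal_nonneg]
          exact Nat.floor_le ENNReal.toReal_nonneg)
      · rw [← ENNReal.ofReal_toReal hne, ← ENNReal.ofReal_natCast,
          ENNReal.ofReal_lt_ofReal_iff (by positivity),
          ENNReal.toReal_ofReal ENNReal.toReal_nonneg]
        exact_mod_cast Nat.lt_floor_add_one _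
    rw [tsum_eq_single k]
    · rw [Kernel.piecewise_apply, if_pos ⟨hk1, hk2⟩]
    · intro j hj
      rw [Kernel.piecewise_apply, if_neg]
      · simp
      · rintro ⟨h1, h2⟩
        have e1 : j < k + 1 := by exact_mod_cast h1.trans_lt hk2
        have e2 : k < j + 1 := by exact_mod_cast hk1.trans_lt h2
        omega
  rw [hsum]
  exact Kernel.isSFiniteKernel_sum

/-- Finiteness on bounded sets. -/
def LocFin {d : ℕ} (N : Measure (Space d)) : Prop :=
  ∀ n : ℕ, N (Metric.closedBall 0 n) < ∞

theorem LocFin.lt_top {d : ℕ} {N : Measure (Space d)} (h : LocFin N) {B : Set (Space d)}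
    (hB : Bornology.IsBounded B) : N B < ∞ := by
  obtain ⟨R, hR⟩ := hB.subset_closedBall (0 : Space d)
  obtain ⟨n, hn⟩ := exists_nat_ge R
  exact (measure_mono (hR.trans (Metric.closedBall_subset_closedBall hn))).trans_lt (h n)

theorem measurableSet_locFin (d : ℕ) : MeasurableSet {N : Measure (Space d) | LocFin N} := by
  have : {N : Measure (Space d) | LocFin N} = ⋂ n : ℕ, {N | N (Metric.closedBall 0 n) < ∞} := by
    ext N; simp [LocFin]
  rw [this]
  exact MeasurableSet.iInter fun n =>
    measurableSet_lt (Measure.measurable_coe Metric.isClosed_closedBall.measurableSet)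
      measurable_const

open Classical in
/-- The measure itself if it is finite on bounded sets, and zero otherwise. -/
def locFinPart {d : ℕ} (N : Measure (Space d)) : Measure (Space d) := if LocFin N then N else 0

theorem LocFin.locFinPart_eq {d : ℕ} {N : Measure (Space d)} (h : LocFin N) :
    locFinPart N = N := if_pos h

theorem locFin_locFinPart {d : ℕ} (N : Measure (Space d)) : LocFin (locFinPart N) := by
  unfold locFinPart
  split_ifs with h
  · exact h
  · intro n; simp

theorem measurable_locFinPart (d : ℕ) :
    Measurable (locFinPart : Measure (Space d) → Measure (Space d)) := by
  classical
  exact Measurable.ite (measurableSet_locFin d) measurable_id measurable_const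

/-- The measures that are finite on bounded sets, as a kernel. -/
def locFinKernel (d : ℕ) : Kernel (Measure (Space d)) (Space d) :=
  ⟨locFinPart, measurable_locFinPart d⟩

theorem locFinKernel_apply {d : ℕ} (N : Measure (Space d)) : locFinKernel d N = locFinPart N := rfl

/-- Restricted to one annulus, every measure in the kernel has finite mass; the annuli sum up to the
whole kernel. -/
instance (d : ℕ) : IsSFiniteKernel (locFinKernel d) := by
  have hmono : Monotone fun n : ℕ => Metric.closedBall (0 : Space d) n := fun m n h =>
    Metric.closedBall_subset_closedBall (by exact_mod_cast h)
  set A : ℕ → Set (Space d) := disjointed fun n => Metric.closedBall (0 : Space d) n with hA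
  have hAm : ∀ n, MeasurableSet (A n) :=
    MeasurableSet.disjointed fun n => Metric.isClosed_closedBall.measurableSet
  have hU : ⋃ n, A n = Set.univ := by
    rw [hA, iUnion_disjointed]
    exact Metric.iUnion_closedBall_nat 0
  have hsum : locFinKernel d = Kernel.sum fun n => (locFinKernel d).restrict (hAm n) := by
    ext N B hB
    rw [Kernel.sum_apply' _ _ hB]
    simp_rw [Kernel.restrict_apply' _ (hAm _) _ hB]
    rw [← measure_iUnion, ← Set.inter_iUnion, hU, Set.inter_univ]
    · exact fun i j hij => (disjoint_disjointed _ hij).mono Set.inter_subset_right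
        Set.inter_subset_right
    · exact fun n => hB.inter (hAm n)
  have : ∀ n, IsSFiniteKernel ((locFinKernel d).restrict (hAm n)) := fun n =>
    isSFiniteKernel_of_forall_lt_top _ fun N => by
      rw [Kernel.restrict_apply' _ _ _ MeasurableSet.univ, Set.univ_inter]
      exact (measure_mono (disjointed_subset _ n)).trans_lt (locFin_locFinPart N n)
  rw [hsum]
  exact Kernel.isSFiniteKernel_sum

theorem isBounded_cube {d : ℕ} (s : ℝ) (x : Space d) : Bornology.IsBounded (cube s x) := by
  refine (Metric.isBounded_closedBall (x := x) (r := √(∑ _i : Fin d, (s / 2) ^ 2))).subset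
    fun y hy => ?_
  rw [Metric.mem_closedBall, EuclideanSpace.dist_eq]
  refine Real.sqrt_le_sqrt (Finset.sum_le_sum fun i _ => ?_)
  rw [Real.dist_eq, ← sq_abs, abs_abs]
  exact pow_le_pow_left₀ (abs_nonneg _) (hy i) 2

theorem measurableSet_cube {d : ℕ} (s : ℝ) (x : Space d) : MeasurableSet (cube s x) := by
  have : cube s x = ⋂ i, {y | |y i - x i| ≤ s / 2} := by ext; simp [cube]
  rw [this]
  exact MeasurableSet.iInter fun i => measurableSet_le (by fun_prop) measurable_const

theorem shift_apply {d : ℕ} (x : Space d) (μ : Measure (Space d)) {B : Set (Space d)}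
    (hB : MeasurableSet B) : shift x μ B = μ {y | y - x ∈ B} :=
  Measure.map_apply (by fun_prop) hB

theorem measurable_shift_locFinPart (d : ℕ) :
    Measurable fun p : Measure (Space d) × Space d => shift p.2 (locFinPart p.1) := by
  refine Measure.measurable_of_measurable_coe _ fun B hB => ?_
  have hT : MeasurableSet {q : (Measure (Space d) × Space d) × Space d | q.2 - q.1.2 ∈ B} :=
    (measurable_snd.sub (measurable_snd.comp measurable_fst)) hB
  have := Kernel.measurable_kernel_prodMk_left
    (κ := Kernel.prodMkRight (Space d) (locFinKernel d)) hT
  convert this using 2 with p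
  rw [shift_apply _ _ hB, Kernel.prodMkRight_apply]
  rfl

theorem LocFin.measurable_shift {d : ℕ} {N : Measure (Space d)} (h : LocFin N) :
    Measurable fun x => shift x N := by
  have := (measurable_shift_locFinPart d).comp (measurable_prodMk_left (x := N))
  simpa only [Function.comp_def, h.locFinPart_eq] using this

/-- The contribution of a fixed measure to the Palm measure. -/
def palmKernel {d : ℕ} (N : Measure (Space d)) : Measure (Measure (Space d)) :=
  ((locFinPart N).restrict (cube 1 0)).map fun x => shift x (locFinPart N)

theorem measurable_lintegral_shift {d : ℕ} {f : Measure (Space d) → ℝ≥0∞} (hf : Measurable f) :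
    Measurable fun N : Measure (Space d) =>
      ∫⁻ x in cube 1 0, f (shift x (locFinPart N)) ∂(locFinPart N) :=
  Measurable.setLIntegral_kernel_prod_right (κ := locFinKernel d)
    (f := fun N x => f (shift x (locFinPart N))) (hf.comp (measurable_shift_locFinPart d))
    (measurableSet_cube 1 0)

theorem lintegral_palmKernel {d : ℕ} {f : Measure (Space d) → ℝ≥0∞} (hf : Measurable f)
    (N : Measure (Space d)) : ∫⁻ μ, f μ ∂(palmKernel N) =
      ∫⁻ x in cube 1 0, f (shift x (locFinPart N)) ∂(locFinPart N) :=
  lintegral_map hf (locFin_locFinPart N).measurable_shift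

theorem measurable_palmKernel (d : ℕ) :
    Measurable (palmKernel : Measure (Space d) → Measure (Measure (Space d))) := by
  refine Measure.measurable_of_measurable_coe _ fun T hT => ?_
  convert measurable_lintegral_shift (measurable_one.indicator hT) using 2 with N
  rw [← lintegral_palmKernel (measurable_one.indicator hT), lintegral_indicator_one hT]

/-! ### Integration against Palm measures. -/

section Palm

variable {d : ℕ} {Ω : Type*} [MeasurableSpace Ω] {P : Measure Ω} {M : Ω → Measure (Space d)}

theorem palm_eq_bind (hM : Measurable M) (h : ∀ᵐ ω ∂P, LocFin (M ω)) :
    palm P M = (P.map M).bind palmKernel := by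
  have h1 : palm P M = P.bind fun ω => palmKernel (M ω) := by
    refine Measure.bind_congr_right ?_
    filter_upwards [h] with ω hω
    rw [palmKernel, hω.locFinPart_eq]
  rw [h1, Measure.bind, Measure.bind, Measure.map_map (measurable_palmKernel d) hM]
  rfl

theorem lintegral_palm (hM : Measurable M) (h : ∀ᵐ ω ∂P, LocFin (M ω))
    {f : Measure (Space d) → ℝ≥0∞} (hf : Measurable f) :
    ∫⁻ μ, f μ ∂(palm P M) =
      ∫⁻ N, ∫⁻ x in cube 1 0, f (shift x (locFinPart N)) ∂(locFinPart N) ∂(P.map M) := by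
  rw [palm_eq_bind hM h, Measure.lintegral_bind (measurable_palmKernel d).aemeasurable
    hf.aemeasurable]
  simp_rw [lintegral_palmKernel hf]

theorem lintegral_palm' (hM : Measurable M) (h : ∀ᵐ ω ∂P, LocFin (M ω))
    {f : Measure (Space d) → ℝ≥0∞} (hf : Measurable f) :
    ∫⁻ μ, f μ ∂(palm P M) = ∫⁻ ω, ∫⁻ x in cube 1 0, f (shift x (M ω)) ∂(M ω) ∂P := by
  rw [lintegral_palm hM h hf, lintegral_map (measurable_lintegral_shift hf) hM]
  refine lintegral_congr_ae ?_
  filter_upwards [h] with ω hω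
  rw [hω.locFinPart_eq]

theorem palm_univ (hM : Measurable M) (h : ∀ᵐ ω ∂P, LocFin (M ω)) :
    palm P M Set.univ = ∫⁻ ω, M ω (cube 1 0) ∂P := by
  rw [← lintegral_one, lintegral_palm' hM h measurable_const]
  simp

theorem ae_palm (hM : Measurable M) (h : ∀ᵐ ω ∂P, LocFin (M ω)) {T : Set (Measure (Space d))}
    (hT : MeasurableSet T) (hMT : ∀ᵐ ω ∂P, ∀ᵐ x ∂(M ω), shift x (M ω) ∈ T) :
    ∀ᵐ μ ∂(palm P M), μ ∈ T := by
  have h0 : palm P M Tᶜ = 0 := by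
    rw [← lintegral_indicator_one hT.compl, lintegral_palm' hM h (measurable_one.indicator hT.compl)]
    refine (lintegral_congr_ae ?_).trans lintegral_zero
    filter_upwards [hMT] with ω hω
    refine (lintegral_congr_ae (ae_restrict_of_ae ?_)).trans lintegral_zero
    filter_upwards [hω] with x hx
    simp [hx]
  exact mem_ae_iff.mpr h0

end Palm

/-! ### Counting measures and their points. -/

theorem LocFin.shift {d : ℕ} {N : Measure (Space d)} (h : LocFin N) (x : Space d) :
    LocFin (shift x N) := by
  intro n
  rw [shift_apply _ _ Metric.isClosed_closedBall.measurableSet]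
  refine h.lt_top ((Metric.isBounded_closedBall (x := x) (r := n)).subset fun y hy => ?_)
  simpa [dist_eq_norm] using hy

/-- The counting measures: finite on bounded sets and with integer values. -/
def CountingMeasures (d : ℕ) : Set (Measure (Space d)) :=
  {N | LocFin N ∧ ∀ B : Set (Space d), MeasurableSet B → ∃ n : ℕ∞, N B = (n : ℝ≥0∞)}

theorem shift_mem_countingMeasures {d : ℕ} {N : Measure (Space d)} (h : N ∈ CountingMeasures d)
    (x : Space d) : shift x N ∈ CountingMeasures d := by
  refine ⟨h.1.shift x, fun B hB => ?_⟩
  rw [shift_apply _ _ hB]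
  exact h.2 _ ((measurable_id.sub_const x) hB)

/-- Integrality on all Borel sets follows from integrality on a countable generating algebra
intersected with balls: a π-λ argument, where finiteness on balls handles complements and closedness
of the integers in `[0, ∞]` handles countable unions. -/
theorem measurableSet_countingMeasures (d : ℕ) : MeasurableSet (CountingMeasures d) := by
  set R : Set ℝ≥0∞ := Set.range ENat.toENNReal with hR
  have hRc : IsClosed R := ENat.isClosedEmbedding_toENNReal.isClosed_range
  set A : Set (Set (Space d)) := generateSetAlgebra (TopologicalSpace.countableBasis (Space d))
    with hA
  have hAlg : IsSetAlgebra A := isSetAlgebra_generateSetAlgebra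
  have hAc : A.Countable :=
    countable_generateSetAlgebra (TopologicalSpace.countable_countableBasis _)
  have hgen : (inferInstance : MeasurableSpace (Space d)) = MeasurableSpace.generateFrom A := by
    rw [hA, generateFrom_generateSetAlgebra_eq, BorelSpace.measurable_eq (α := Space d)]
    exact (TopologicalSpace.isBasis_countableBasis _).borel_eq_generateFrom
  have hAm : ∀ s ∈ A, MeasurableSet s := fun s hs =>
    hgen.ge s (MeasurableSpace.measurableSet_generateFrom hs)
  have hball : ∀ n : ℕ, MeasurableSet (Metric.closedBall (0 : Space d) n) := fun n =>
    Metric.isClosed_closedBall.measurableSet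
  have key : CountingMeasures d = {N | LocFin N} ∩
      ⋂ s ∈ A, ⋂ n : ℕ, {N | N (s ∩ Metric.closedBall 0 n) ∈ R} := by
    ext N
    simp only [CountingMeasures, Set.mem_ofPred_eq, Set.mem_inter_iff, Set.mem_iInter]
    refine and_congr_right fun hN => ⟨fun h s hs n => ?_, fun h B hB => ?_⟩
    · obtain ⟨m, hm⟩ := h _ ((hAm s hs).inter (hball n))
      exact ⟨m, hm.symm⟩
    have hK : ∀ n : ℕ, ∀ B, MeasurableSet B → N (B ∩ Metric.closedBall 0 n) ∈ R := by
      intro n B hB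
      induction B, hB using MeasurableSpace.induction_on_inter hgen
        (fun s hs t ht _ => hAlg.inter_mem hs ht) with
      | empty => exact ⟨0, by simp⟩
      | basic s hs => exact h s hs n
      | compl t ht ih =>
        obtain ⟨a, ha⟩ := ih
        obtain ⟨b, hb⟩ := h _ hAlg.univ_mem n
        rw [Set.univ_inter] at hb
        refine ⟨b - a, ?_⟩
        have : tᶜ ∩ Metric.closedBall (0 : Space d) n =
            Metric.closedBall 0 n \ (t ∩ Metric.closedBall 0 n) := by
          ext x; simp; tauto
        rw [this, measure_sdiff Set.inter_subset_right (ht.inter (hball n)).nullMeasurableSet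
          ((measure_mono Set.inter_subset_right).trans_lt (hN n)).ne, ← ha, ← hb,
          ENat.toENNReal_sub]
      | iUnion f hd hf ih =>
        rw [Set.iUnion_inter, measure_iUnion
          (fun i j hij => (hd hij).mono Set.inter_subset_left Set.inter_subset_left)
          fun i => (hf i).inter (hball n)]
        refine hRc.mem_of_tendsto (ENNReal.tendsto_nat_tsum _) (Eventually.of_forall fun m => ?_)
        induction m with
        | zero => exact ⟨0, by simp⟩
        | succ m ihm =>
          obtain ⟨a, ha⟩ := ihm
          obtain ⟨b, hb⟩ := ih m
          exact ⟨a + b, by rw [Finset.sum_range_succ, ← ha, ← hb, ENat.toENNReal_add]⟩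
    have hmono : Monotone fun n : ℕ => B ∩ Metric.closedBall (0 : Space d) n := fun m n h =>
      Set.inter_subset_inter_right _ (Metric.closedBall_subset_closedBall (by exact_mod_cast h))
    have hlim := tendsto_measure_iUnion_atTop (μ := N) hmono
    rw [← Set.inter_iUnion, Metric.iUnion_closedBall_nat, Set.inter_univ] at hlim
    obtain ⟨m, hm⟩ := hRc.mem_of_tendsto hlim (Eventually.of_forall fun n => hK n B hB)
    exact ⟨m, hm.symm⟩
  rw [key]
  refine (measurableSet_locFin d).inter (MeasurableSet.biInter hAc fun s hs =>
    MeasurableSet.iInter fun n => ?_)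
  exact Measure.measurable_coe ((hAm s hs).inter (hball n)) hRc.measurableSet

/-- Small balls around a non-atom have mass tending to zero, hence mass below one, hence mass zero
by integrality. So the set is locally null. -/
theorem CountingMeasures.measure_eq_zero {d : ℕ} {N : Measure (Space d)}
    (h : N ∈ CountingMeasures d) {B : Set (Space d)} (hB : ∀ x ∈ B, N {x} = 0) : N B = 0 := by
  refine measure_null_of_locally_null B fun x hx => ?_
  have hlim := tendsto_measure_iInter_atTop (μ := N)
    (s := fun n : ℕ => Metric.closedBall x (1 / (n + 1 : ℝ)))
    (fun n => Metric.isClosed_closedBall.measurableSet.nullMeasurableSet)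
    (fun m n hmn => Metric.closedBall_subset_closedBall
      (one_div_le_one_div_of_le (by positivity) (by exact_mod_cast Nat.succ_le_succ hmn)))
    ⟨0, (h.1.lt_top Metric.isBounded_closedBall).ne⟩
  have hI : ⋂ n : ℕ, Metric.closedBall x (1 / (n + 1 : ℝ)) = {x} := by
    ext y
    simp only [Set.mem_iInter, Metric.mem_closedBall, Set.mem_singleton_iff]
    refine ⟨fun hy => dist_le_zero.mp (ge_of_tendsto' tendsto_one_div_add_atTop_nhds_zero_nat hy),
      fun hy n => by subst hy; simp; positivity⟩
  rw [hI, hB x hx] at hlim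
  obtain ⟨n, hn⟩ := ((tendsto_order.1 hlim).2 1 one_pos).exists
  obtain ⟨m, hm⟩ := h.2 (Metric.closedBall x (1 / (n + 1 : ℝ)))
    Metric.isClosed_closedBall.measurableSet
  simp only [Function.comp_def] at hn
  rw [hm] at hn
  have hm0 : m = 0 := by
    have : m < 1 := by exact_mod_cast hn
    simpa using this
  refine ⟨Metric.closedBall x (1 / (n + 1 : ℝ)),
    mem_nhdsWithin_of_mem_nhds (Metric.closedBall_mem_nhds x (by positivity)), ?_⟩
  rw [hm, hm0]; simp

theorem CountingMeasures.one_le {d : ℕ} {N : Measure (Space d)}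
    (h : N ∈ CountingMeasures d) {x : Space d} (hx : x ∈ points N) : 1 ≤ N {x} := by
  obtain ⟨m, hm⟩ := h.2 {x} (measurableSet_singleton x)
  have hx' : N {x} ≠ 0 := hx
  rw [hm] at hx' ⊢
  have : m ≠ 0 := by rintro rfl; simp at hx'
  exact_mod_cast Order.one_le_iff_pos.mpr (pos_iff_ne_zero.mpr this)

theorem CountingMeasures.finite_points {d : ℕ} {N : Measure (Space d)}
    (h : N ∈ CountingMeasures d) {B : Set (Space d)} (hB : Bornology.IsBounded B) :
    (points N ∩ B).Finite := by
  have := Measure.finite_const_le_meas_of_disjoint_iUnion N one_pos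
    (As := fun x : ↥(points N ∩ B) => ({x.1} : Set (Space d)))
    (fun x => measurableSet_singleton _)
    (fun x y hxy => by simpa [Function.onFun, Subtype.ext_iff] using fun h => hxy (Subtype.ext h))
    (ne_top_of_le_ne_top (h.1.lt_top hB).ne (measure_mono
      (Set.iUnion_subset fun x => Set.singleton_subset_iff.mpr x.2.2)))
  rw [Set.eq_univ_of_forall (s := {x : ↥(points N ∩ B) | 1 ≤ N {x.1}})
    fun x => CountingMeasures.one_le h x.2.1, Set.finite_univ_iff] at this
  exact Set.toFinite _

theorem CountingMeasures.exists_point {d : ℕ} {N : Measure (Space d)}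
    (h : N ∈ CountingMeasures d) {B : Set (Space d)} (hB : N B ≠ 0) : ∃ x ∈ B, x ∈ points N := by
  by_contra! hno
  exact hB (CountingMeasures.measure_eq_zero h fun x hx => not_not.mp (hno x hx))

/-! ### Poisson variables: void probability and mean. -/

/-- The probability that a Poisson variable with parameter `t ∈ [0, ∞]` vanishes. -/
def voidProb (t : ℝ≥0∞) : ℝ≥0∞ := EReal.exp (-(t : EReal))

theorem voidProb_zero : voidProb 0 = 1 := by simp [voidProb]

theorem voidProb_top : voidProb ∞ = 0 := by simp [voidProb]

theorem voidProb_ofReal {t : ℝ} (ht : 0 ≤ t) :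
    voidProb (ENNReal.ofReal t) = ENNReal.ofReal (Real.exp (-t)) := by
  rw [voidProb, EReal.coe_ennreal_ofReal, max_eq_left ht, ← EReal.coe_neg, EReal.exp_coe]

theorem voidProb_antitone : Antitone voidProb := fun _ _ h =>
  EReal.exp_monotone (EReal.neg_le_neg_iff.mpr (EReal.coe_ennreal_le_coe_ennreal_iff.mpr h))

theorem measurable_voidProb : Measurable voidProb := voidProb_antitone.measurable

theorem poissonLaw_singleton_zero (t : ℝ≥0∞) : poissonLaw t {0} = voidProb t := by
  unfold poissonLaw
  split_ifs with h
  · subst h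
    rw [voidProb_top, Measure.dirac_apply' _ (measurableSet_singleton 0)]
    simp
  · lift t to ℝ≥0 using h
    rw [Measure.map_apply (by fun_prop) (measurableSet_singleton 0)]
    have : (fun n : ℕ => (n : ℝ≥0∞)) ⁻¹' {0} = {0} := by ext; simp
    rw [this, ENNReal.toNNReal_coe, poissonMeasure_singleton]
    rw [← ENNReal.ofReal_coe_nnreal, voidProb_ofReal (NNReal.coe_nonneg t)]
    simp

theorem lintegral_poissonLaw (t : ℝ≥0∞) : ∫⁻ x, x ∂(poissonLaw t) = t := by
  unfold poissonLaw
  split_ifs with h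
  · subst h
    exact lintegral_dirac' _ measurable_id
  · lift t to ℝ≥0 using h
    rw [lintegral_map (f := fun x => x) measurable_id (by fun_prop), lintegral_countable', ENNReal.toNNReal_coe]
    have h1 : ∀ n : ℕ, ((n + 1 : ℕ) : ℝ≥0∞) * poissonMeasure t {n + 1} =
        (t : ℝ≥0∞) * poissonMeasure t {n} := by
      intro n
      rw [poissonMeasure_singleton, poissonMeasure_singleton, ← ENNReal.ofReal_natCast, ← ENNReal.ofReal_coe_nnreal,
        ← ENNReal.ofReal_mul (by positivity), ← ENNReal.ofReal_mul (by positivity)]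
      congr 1
      rw [Nat.factorial_succ]
      push_cast
      field_simp
      ring
    have h2 : ∑' n : ℕ, poissonMeasure t {n} = 1 := by
      have := lintegral_countable' (μ := poissonMeasure t) fun _ => 1
      simpa using this.symm
    have h3 : ∀ f : ℕ → ℝ≥0∞, ∑' n, f n = f 0 + ∑' n, f (n + 1) := fun f =>
      tsum_eq_zero_add' ENNReal.summable
    refine (h3 _).trans ?_
    rw [tsum_congr h1, ENNReal.tsum_mul_left, h2, mul_one, Nat.cast_zero, zero_mul, zero_add]

theorem poissonLaw_singleton_top {t : ℝ≥0∞} (h : t ≠ ∞) : poissonLaw t {∞} = 0 := by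
  rw [poissonLaw, if_neg h, Measure.map_apply (by fun_prop) (measurableSet_singleton _)]
  have : (fun n : ℕ => (n : ℝ≥0∞)) ⁻¹' {∞} = ∅ := by ext; simp
  rw [this, measure_empty]

/-! ### Poisson processes and the Mecke formula for void events. -/

section Poisson

variable {d : ℕ} {μ : Measure (Space d)} {Q : Measure (Measure (Space d))}

theorem IsPoissonProcess.void (hQ : IsPoissonProcess μ Q) {D : Set (Space d)}
    (hD : MeasurableSet D) : Q {N | N D = 0} = voidProb (μ D) := by
  rw [← poissonLaw_singleton_zero, ← hQ.map_count D hD,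
    Measure.map_apply (Measure.measurable_coe hD) (measurableSet_singleton 0)]
  rfl

theorem IsPoissonProcess.lintegral (hQ : IsPoissonProcess μ Q) {B : Set (Space d)}
    (hB : MeasurableSet B) : ∫⁻ N, N B ∂Q = μ B := by
  rw [← lintegral_poissonLaw (μ B), ← hQ.map_count B hB,
    lintegral_map (f := fun x => x) measurable_id (Measure.measurable_coe hB)]

theorem IsPoissonProcess.ae_mem_countingMeasures (hQ : IsPoissonProcess μ Q) (hμ : LocFin μ) :
    ∀ᵐ N ∂Q, N ∈ CountingMeasures d := by
  have h : ∀ᵐ N ∂Q, ∀ n : ℕ, N (Metric.closedBall 0 n) < ∞ := by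
    refine ae_all_iff.mpr fun n => ?_
    have hm : MeasurableSet (Metric.closedBall (0 : Space d) n) :=
      Metric.isClosed_closedBall.measurableSet
    have := poissonLaw_singleton_top (hμ n).ne
    rw [← hQ.map_count _ hm, Measure.map_apply (Measure.measurable_coe hm)
      (measurableSet_singleton _)] at this
    refine (measure_eq_zero_iff_ae_notMem.mp this).mono fun N hN => lt_top_iff_ne_top.mpr hN
  filter_upwards [h, hQ.counting] with N h1 h2 using ⟨h1, h2⟩

/-- On the void event only the points of `B \ D` count, and their number is independent of the
number in `D`. -/
theorem IsPoissonProcess.setLIntegral_void (hQ : IsPoissonProcess μ Q) {B D : Set (Space d)}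
    (hB : MeasurableSet B) (hD : MeasurableSet D) :
    ∫⁻ N in {N | N D = 0}, N B ∂Q = μ (B \ D) * voidProb (μ D) := by
  have hmD : MeasurableSet {N : Measure (Space d) | N D = 0} :=
    Measure.measurable_coe hD (measurableSet_singleton 0)
  have hind := (hQ.indep 2 ![B \ D, D] (by intro i; fin_cases i <;> simp [hB.diff hD, hD]) (by
    intro i j hij
    fin_cases i <;> fin_cases j <;>
      simp_all [Set.disjoint_sdiff_left, Set.disjoint_sdiff_right])).indepFun
    (show (0 : Fin 2) ≠ 1 by decide)
  simp only [Matrix.cons_val_zero, Matrix.cons_val_one] at hind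
  have hind' := hind.comp measurable_id
    (show Measurable (Set.indicator {(0 : ℝ≥0∞)} (1 : ℝ≥0∞ → ℝ≥0∞)) from
      measurable_one.indicator (measurableSet_singleton 0))
  have hmul := lintegral_mul_eq_lintegral_mul_lintegral_of_indepFun
    (Measure.measurable_coe (hB.diff hD))
    ((show Measurable (Set.indicator {(0 : ℝ≥0∞)} (1 : ℝ≥0∞ → ℝ≥0∞)) from
      measurable_one.indicator (measurableSet_singleton 0)).comp (Measure.measurable_coe hD)) hind'
  have h2 : ∫⁻ N : Measure (Space d), ((Set.indicator {(0 : ℝ≥0∞)} (1 : ℝ≥0∞ → ℝ≥0∞)) ∘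
      fun N : Measure (Space d) => N D) N ∂Q = voidProb (μ D) := by
    rw [← hQ.void hD, ← lintegral_indicator_one hmD]
    rfl
  rw [h2, hQ.lintegral (hB.diff hD)] at hmul
  rw [← hmul, ← lintegral_indicator hmD]
  refine lintegral_congr fun N => ?_
  by_cases hN : N D = 0
  · have : N B = N (B \ D) := by
      refine le_antisymm ?_ (measure_mono Set.sdiff_subset)
      calc N B ≤ N (B \ D ∪ D) := measure_mono (by intro x hx; by_cases x ∈ D <;> simp [*])
        _ ≤ N (B \ D) + N D := measure_union_le _ _
        _ = N (B \ D) := by rw [hN, add_zero]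
    simp [hN, this]
  · simp [hN]

/-- The measurable rectangles of void events and Borel sets. -/
def voidRectangles (d : ℕ) : Set (Set (Measure (Space d) × Space d)) :=
  {R | ∃ D B : Set (Space d), MeasurableSet D ∧ MeasurableSet B ∧ R = {N | N D = 0} ×ˢ B}

theorem isPiSystem_voidRectangles (d : ℕ) : IsPiSystem (voidRectangles d) := by
  rintro _ ⟨D, B, hD, hB, rfl⟩ _ ⟨D', B', hD', hB', rfl⟩ _
  refine ⟨D ∪ D', B ∩ B', hD.union hD', hB.inter hB', ?_⟩
  rw [Set.prod_inter_prod]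
  congr 1
  ext N
  simp [measure_union_null_iff]

theorem generateFrom_voidRectangles_le (d : ℕ) :
    MeasurableSpace.generateFrom (voidRectangles d) ≤
      (inferInstance : MeasurableSpace (Measure (Space d) × Space d)) := by
  refine MeasurableSpace.generateFrom_le ?_
  rintro _ ⟨D, B, hD, hB, rfl⟩
  exact (Measure.measurable_coe hD (measurableSet_singleton 0)).prod hB

/-- The set of pairs `(N, x)` such that `N` has no mass in `x + S`. -/
def voidPairs {d : ℕ} (S : Set (Space d)) : Set (Measure (Space d) × Space d) :=
  {p | p.1 {y | y - p.2 ∈ S} = 0}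

/-- As `S` is open, `x + S` is a union of balls from a fixed countable family, with measurable
conditions on `x` deciding which balls occur. So the complement is a countable union of differences
of rectangles. -/
theorem measurableSet_voidPairs {d : ℕ} {S : Set (Space d)} (hS : IsOpen S) :
    MeasurableSet[MeasurableSpace.generateFrom (voidRectangles d)] (voidPairs S) := by
  set q := TopologicalSpace.denseSeq (Space d) with hq
  set ρ : ℕ → ℝ := fun k => 1 / (k + 1 : ℝ) with hρ
  have hρ0 : ∀ k, 0 < ρ k := fun k => by positivity
  set W : ℕ → ℕ → Set (Space d) := fun n k =>
    {x | ENNReal.ofReal (ρ k) < Metric.infEDist (q n - x) Sᶜ} with hW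
  have hWm : ∀ n k, MeasurableSet (W n k) := fun n k =>
    (isOpen_lt continuous_const
      (Metric.continuous_infEDist.comp (continuous_const.sub continuous_id))).measurableSet
  have hcover : ∀ x, {y | y - x ∈ S} = ⋃ n, ⋃ k, ⋃ (_ : x ∈ W n k), Metric.ball (q n) (ρ k) := by
    intro x
    ext y
    simp only [Set.mem_ofPred_eq, Set.mem_iUnion, Metric.mem_ball, exists_prop]
    constructor
    · intro hy
      have hpos : 0 < Metric.infEDist (y - x) Sᶜ := by
        rw [Metric.infEDist_pos_iff_notMem_closure, hS.isClosed_compl.closure_eq]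
        simpa using hy
      obtain ⟨ε, hε0, hε⟩ := ENNReal.lt_iff_exists_real_btwn.mp hpos
      obtain ⟨hε1, hε2⟩ := hε
      have hε' : 0 < ε := by simpa using hε1
      obtain ⟨k, hk⟩ := exists_nat_one_div_lt (half_pos hε')
      obtain ⟨n, hn⟩ := (TopologicalSpace.denseRange_denseSeq (Space d)).exists_dist_lt y (hρ0 k)
      refine ⟨n, k, ?_, hn⟩
      by_contra hle
      have h1 : Metric.infEDist (y - x) Sᶜ ≤
          Metric.infEDist (q n - x) Sᶜ + edist (y - x) (q n - x) :=
        Metric.infEDist_le_infEDist_add_edist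
      rw [edist_sub_right, edist_dist] at h1
      have h2 := hε2.trans_le (h1.trans (add_le_add (not_lt.mp hle)
        (ENNReal.ofReal_le_ofReal hn.le)))
      rw [← ENNReal.ofReal_add (hρ0 k).le (hρ0 k).le,
        ENNReal.ofReal_lt_ofReal_iff_of_nonneg hε'.le] at h2
      simp only [hρ] at h2
      linarith
    · rintro ⟨n, k, h1, h2⟩
      by_contra hy
      have h3 : Metric.infEDist (q n - x) Sᶜ ≤ edist (q n - x) (y - x) :=
        Metric.infEDist_le_edist_of_mem hy
      rw [edist_sub_right, edist_dist] at h3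
      have := h1.trans_le h3
      rw [ENNReal.ofReal_lt_ofReal_iff_of_nonneg (hρ0 k).le, dist_comm] at this
      exact absurd this (not_lt.mpr h2.le)
  have hcompl : (voidPairs S)ᶜ = ⋃ n, ⋃ k,
      (({N | N ∅ = 0} ×ˢ W n k) \ ({N | N (Metric.ball (q n) (ρ k)) = 0} ×ˢ W n k)) := by
    ext ⟨N, x⟩
    simp only [voidPairs, Set.mem_compl_iff, Set.mem_ofPred_eq, hcover x, measure_iUnion_null_iff]
    simp only [Set.mem_iUnion, Set.mem_sdiff, Set.mem_prod, Set.mem_ofPred_eq, measure_empty]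
    push Not
    simp only [true_and]
    refine exists_congr fun n => exists_congr fun k => ?_
    tauto
  refine MeasurableSet.of_compl ?_
  rw [hcompl]
  refine MeasurableSet.iUnion fun n => MeasurableSet.iUnion fun k => MeasurableSet.diff ?_ ?_
  · exact MeasurableSpace.measurableSet_generateFrom
      ⟨∅, W n k, MeasurableSet.empty, hWm n k, rfl⟩
  · exact MeasurableSpace.measurableSet_generateFrom
      ⟨_, W n k, Metric.isOpen_ball.measurableSet, hWm n k, rfl⟩

theorem measurable_add_dirac (d : ℕ) :
    Measurable fun p : Measure (Space d) × Space d => p.1 + Measure.dirac p.2 := by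
  refine Measure.measurable_of_measurable_coe _ fun B hB => ?_
  simp only [Measure.add_apply]
  exact ((Measure.measurable_coe hB).comp measurable_fst).add
    (((Measure.measurable_coe hB).comp Measure.measurable_dirac).comp measurable_snd)

/-- The Mecke formula for void events. -/
theorem IsPoissonProcess.mecke_void (hQ : IsPoissonProcess μ Q) (hμ : LocFin μ)
    {S : Set (Space d)} (hS : IsOpen S) :
    ∫⁻ N, ∫⁻ x in cube 1 0, Set.indicator {N | N S = 0} 1 (shift x (locFinPart N)) ∂(locFinPart N) ∂Q =
      ∫⁻ x in cube 1 0, Sᶜ.indicator 1 (0 : Space d) * voidProb (shift x μ S) ∂μ := by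
  have := hQ.isProbabilityMeasure
  have hcube : MeasurableSet (cube 1 0 : Set (Space d)) := measurableSet_cube 1 0
  have hμc : μ (cube 1 0) < ∞ := hμ.lt_top (isBounded_cube 1 0)
  have hfin : IsFiniteMeasure (μ.restrict (cube 1 0)) := ⟨by simpa using hμc⟩
  have hae : ∀ᵐ N ∂Q, locFinPart N = N := by
    filter_upwards [hQ.ae_mem_countingMeasures hμ] with N hN using hN.1.locFinPart_eq
  set C₁ : Measure (Measure (Space d) × Space d) := Q ⊗ₘ (locFinKernel d).restrict hcube with hC₁
  set C₂ : Measure (Measure (Space d) × Space d) :=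
    (Q.prod (μ.restrict (cube 1 0))).map (fun p => (p.1 + Measure.dirac p.2, p.2)) with hC₂
  have hmap : Measurable fun p : Measure (Space d) × Space d =>
      (p.1 + Measure.dirac p.2, p.2) := (measurable_add_dirac d).prodMk measurable_snd
  have h₂ : ∀ T : Set (Measure (Space d) × Space d), MeasurableSet T → C₂ T =
      ∫⁻ x in cube 1 0, Q {N | (N + Measure.dirac x, x) ∈ T} ∂μ := by
    intro T hT
    rw [hC₂, Measure.map_apply hmap hT, Measure.prod_apply_symm (hmap hT)]
    rfl
  -- `C₁` is the Campbell measure and `C₂` the law of the process with an independent point added.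
  -- On the rectangle of `D` and `B` both equal `μ((B ∩ Q_1) \ D)` times the void probability of
  -- `D`.
  have hrect : ∀ R ∈ voidRectangles d, C₁ R = C₂ R := by
    rintro _ ⟨D, B, hD, hB, rfl⟩
    have hmD : MeasurableSet {N : Measure (Space d) | N D = 0} :=
      Measure.measurable_coe hD (measurableSet_singleton 0)
    rw [hC₁, Measure.compProd_apply_prod hmD hB, h₂ _ (hmD.prod hB)]
    have e1 : ∫⁻ N in {N | N D = 0}, (locFinKernel d).restrict hcube N B ∂Q =
        ∫⁻ N in {N | N D = 0}, N (B ∩ cube 1 0) ∂Q := by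
      refine setLIntegral_congr_fun_ae hmD ?_
      filter_upwards [hae] with N hN _
      rw [Kernel.restrict_apply' _ _ _ hB, locFinKernel_apply, hN]
    rw [e1, hQ.setLIntegral_void (hB.inter hcube) hD]
    have e2 : ∀ x, Q {N | (N + Measure.dirac x, x) ∈ {N : Measure (Space d) | N D = 0} ×ˢ B} =
        (B \ D).indicator (fun _ => voidProb (μ D)) x := by
      intro x
      by_cases hx : x ∈ B \ D
      · rw [Set.indicator_of_mem hx, ← hQ.void hD]
        congr 1
        ext N
        simp [Measure.dirac_apply' _ hD, hx.1, hx.2]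
      · rw [Set.indicator_of_notMem hx]
        convert measure_empty (μ := Q)
        ext N
        simp only [Set.mem_ofPred_eq, Set.mem_prod, Measure.add_apply, Measure.dirac_apply' _ hD,
          Set.mem_empty_iff_false, iff_false, not_and]
        intro h1 h2
        exact hx ⟨h2, fun h => by simp [h] at h1⟩
    simp_rw [e2]
    rw [lintegral_indicator (hB.diff hD), setLIntegral_const,
      Measure.restrict_apply (hB.diff hD), mul_comm]
    congr 2
    ext x; simp; tauto
  have huniv : C₁ Set.univ = C₂ Set.univ := by
    have := hrect ({N | N ∅ = 0} ×ˢ Set.univ) ⟨∅, Set.univ, MeasurableSet.empty, MeasurableSet.univ, rfl⟩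
    simpa using this
  have hfin₁ : IsFiniteMeasure C₁ := ⟨by
    rw [huniv, h₂ _ MeasurableSet.univ]
    simpa using hμc⟩
  have hT := measurableSet_voidPairs hS
  have hT' := generateFrom_voidRectangles_le d _ hT
  have key := ext_on_measurableSpace_of_generate_finite _ (voidRectangles d) hrect
    (generateFrom_voidRectangles_le d) rfl (isPiSystem_voidRectangles d) huniv hT
  rw [hC₁, Measure.compProd_apply hT', h₂ _ hT'] at key
  have hSm := hS.measurableSet
  calc _ = ∫⁻ N, (locFinKernel d).restrict hcube N (Prod.mk N ⁻¹' voidPairs S) ∂Q := by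
        refine lintegral_congr_ae ?_
        filter_upwards [hae] with N hN
        rw [Kernel.restrict_apply, locFinKernel_apply, hN,
          ← lintegral_indicator_one (measurable_prodMk_left hT')]
        refine lintegral_congr fun x => ?_
        classical
        rw [Set.indicator_apply, Set.indicator_apply]
        simp only [Set.mem_ofPred_eq, shift_apply _ _ hSm, Set.mem_preimage, voidPairs]
        split_ifs <;> rfl
    _ = _ := by
        rw [key]
        refine lintegral_congr fun x => ?_
        have hSx : MeasurableSet {y | y - x ∈ S} := (measurable_id.sub_const x) hSm
        rw [shift_apply _ _ hSm, ← hQ.void hSx]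
        -- The added point sits at the origin after the shift, so it spoils the void event exactly
        -- when `0 ∈ S`.
        by_cases h0 : (0 : Space d) ∈ S
        · rw [Set.indicator_of_notMem (by simpa using h0), zero_mul]
          convert measure_empty (μ := Q)
          ext N
          simp [voidPairs, Measure.dirac_apply' _ hSx, h0]
        · rw [Set.indicator_of_mem (by simpa using h0), Pi.one_apply, one_mul]
          congr 1
          ext N
          simp [voidPairs, Measure.dirac_apply' _ hSx, h0]

end Poisson

/-! ### Consequences of stationarity. -/

section Stationary

variable {d : ℕ} {Ω : Type*} [MeasurableSpace Ω] {P : Measure Ω} {Lam : Ω → Measure (Space d)}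

theorem measurable_shift_comp (hLam : Measurable Lam) (x : Space d) :
    Measurable fun ω => shift x (Lam ω) :=
  (Measure.measurable_map _ (measurable_id.sub_const x)).comp hLam

theorem IsStationary.lintegral_shift (hstat : IsStationary P Lam) (hLam : Measurable Lam)
    (x : Space d) {g : Measure (Space d) → ℝ≥0∞} (hg : Measurable g) :
    ∫⁻ ω, g (shift x (Lam ω)) ∂P = ∫⁻ ω, g (Lam ω) ∂P := by
  rw [← lintegral_map hg hLam, ← hstat x, lintegral_map hg (measurable_shift_comp hLam x)]

theorem measurableSet_unitCube (d : ℕ) : MeasurableSet (unitCube d) := by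
  have : unitCube d = ⋂ i, (fun y : Space d => y i) ⁻¹' Set.Icc 0 1 := by ext; simp [unitCube]
  rw [this]
  exact MeasurableSet.iInter fun i =>
    (by fun_prop : Measurable fun y : Space d => y i) measurableSet_Icc

theorem IsStationary.ae_locFin (hstat : IsStationary P Lam) (hLam : Measurable Lam)
    (hint : ∫⁻ ω, Lam ω (unitCube d) ∂P = 1) : ∀ᵐ ω ∂P, LocFin (Lam ω) := by
  have hm := Measure.measurable_coe (measurableSet_unitCube d)
  have h : ∀ᵐ ω ∂P, ∀ z : Fin d → ℤ,
      shift (WithLp.toLp 2 fun i => (z i : ℝ)) (Lam ω) (unitCube d) < ∞ := by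
    refine ae_all_iff.mpr fun z => ae_lt_top (hm.comp (measurable_shift_comp hLam _)) ?_
    rw [hstat.lintegral_shift hLam _ hm, hint]
    exact ENNReal.one_ne_top
  filter_upwards [h] with ω hω n
  set I : Finset (Fin d → ℤ) := Fintype.piFinset fun _ => Finset.Icc (-(n : ℤ)) n with hI
  have hsub : Metric.closedBall (0 : Space d) n ⊆
      ⋃ z ∈ I, {y | y - (WithLp.toLp 2 fun i => (z i : ℝ)) ∈ unitCube d} := by
    intro y hy
    rw [mem_closedBall_zero_iff] at hy
    simp only [Set.mem_iUnion, exists_prop]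
    refine ⟨fun i => ⌊y i⌋, ?_, fun i => ?_⟩
    · rw [hI, Fintype.mem_piFinset]
      intro i
      have h1 : |y i| ≤ n := by
        have := PiLp.norm_apply_le y i
        rw [Real.norm_eq_abs] at this
        exact this.trans hy
      rw [abs_le] at h1
      rw [Finset.mem_Icc]
      constructor
      · rw [Int.le_floor]; push_cast; exact h1.1
      · have : (⌊y i⌋ : ℝ) ≤ n := (Int.floor_le _).trans h1.2
        exact_mod_cast this
    · have h1 := Int.floor_le (y i)
      have h2 := Int.lt_floor_add_one (y i)
      simp only [PiLp.sub_apply]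
      constructor <;> linarith
  refine (measure_mono hsub).trans_lt ((measure_biUnion_finset_le _ _).trans_lt ?_)
  refine ENNReal.sum_lt_top.mpr fun z _ => ?_
  have := hω z
  rwa [shift_apply _ _ (measurableSet_unitCube d)] at this

theorem IsStationary.palm_univ (hstat : IsStationary P Lam) (hLam : Measurable Lam)
    (hint : ∫⁻ ω, Lam ω (unitCube d) ∂P = 1) : palm P Lam Set.univ = 1 := by
  rw [CoxPerc.palm_univ hLam (hstat.ae_locFin hLam hint), ← hint,
    ← hstat.lintegral_shift hLam (WithLp.toLp 2 fun _ => (1 / 2 : ℝ))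
      (Measure.measurable_coe (measurableSet_cube 1 0))]
  refine lintegral_congr fun ω => ?_
  rw [shift_apply _ _ (measurableSet_cube 1 0)]
  congr 1
  ext y
  simp only [cube, unitCube, Set.mem_ofPred_eq, PiLp.sub_apply, PiLp.zero_apply, sub_zero, abs_le]
  refine forall_congr' fun i => ?_
  constructor <;> rintro ⟨h1, h2⟩ <;> constructor <;> linarith

/-- The open cube of side `δ` around the lattice point `δ z`. -/
def openCube {d : ℕ} (δ : ℝ) (z : Fin d → ℤ) : Set (Space d) :=
  {y | ∀ i, |y i - δ * z i| < δ / 2}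

theorem isOpen_openCube (δ : ℝ) (z : Fin d → ℤ) : IsOpen (openCube δ z) := by
  have : openCube δ z = ⋂ i, {y | |y i - δ * z i| < δ / 2} := by ext; simp [openCube]
  rw [this]
  exact isOpen_iInter_of_finite fun i => isOpen_lt (by fun_prop) continuous_const

/-- The Palm version looks at cubes with arbitrary centres, an uncountable family. Almost surely the
bound holds for the half-size cubes at a dense sequence of centres, and each cube of side `δ`
contains one of these. -/
theorem IsStationary.ae_palm_openCube (hstat : IsStationary P Lam) (hLam : Measurable Lam)
    (hint : ∫⁻ ω, Lam ω (unitCube d) ∂P = 1) {δ : ℝ} (hδ : 0 < δ) :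
    ∀ᵐ μ ∂(palm P Lam), ∀ z : Fin d → ℤ,
      essInf (fun ω => Lam ω (cube (δ / 2) 0)) P ≤ μ (openCube δ z) := by
  set c := essInf (fun ω => Lam ω (cube (δ / 2) 0)) P with hc
  set q := TopologicalSpace.denseSeq (Space d) with hq
  have hT : ∀ B : Set (Space d), MeasurableSet B → MeasurableSet {μ : Measure (Space d) | c ≤ μ B} :=
    fun B hB => measurableSet_le measurable_const (Measure.measurable_coe hB)
  have hcube := measurableSet_cube (δ / 2) (0 : Space d)
  have h0 : ∀ᵐ μ ∂(P.map Lam), c ≤ μ (cube (δ / 2) 0) :=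
    (ae_map_iff hLam.aemeasurable (hT _ hcube)).mpr ae_essInf_le
  have h1 : ∀ᵐ ω ∂P, ∀ n, c ≤ shift (q n) (Lam ω) (cube (δ / 2) 0) := by
    refine ae_all_iff.mpr fun n => ?_
    rw [← hstat (q n)] at h0
    exact (ae_map_iff (measurable_shift_comp hLam _).aemeasurable (hT _ hcube)).mp h0
  refine ae_all_iff.mpr fun z => ?_
  have hz := (isOpen_openCube δ z).measurableSet
  refine ae_palm hLam (hstat.ae_locFin hLam hint) (hT _ hz) ?_
  filter_upwards [h1] with ω hω
  refine Eventually.of_forall fun x => ?_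
  -- Half-side `δ / 4` plus displacement below `δ / 4` stays strictly below the half-side `δ / 2` of
  -- the open cube.
  obtain ⟨n, hn⟩ := (TopologicalSpace.denseRange_denseSeq (Space d)).exists_dist_lt
    (x + WithLp.toLp 2 fun i => δ * (z i : ℝ)) (show 0 < δ / 4 by positivity)
  refine (hω n).trans ?_
  rw [shift_apply _ _ hcube, shift_apply _ _ hz]
  refine measure_mono fun y hy i => ?_
  have e1 := hy i
  have e2 : |(x + WithLp.toLp 2 fun i => δ * (z i : ℝ)) i - q n i| < δ / 4 := by
    refine lt_of_le_of_lt ?_ hn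
    rw [dist_eq_norm]
    exact PiLp.norm_apply_le (x + (WithLp.toLp 2 fun i => δ * (z i : ℝ)) - q n) i
  simp only [PiLp.sub_apply, PiLp.add_apply, PiLp.zero_apply, sub_zero] at e1 e2 ⊢
  rw [abs_le] at e1
  rw [abs_lt] at e2 ⊢
  constructor <;> linarith [e1.1, e1.2, e2.1, e2.2]

theorem shift_smul (x : Space d) (a : ℝ≥0∞) (μ : Measure (Space d)) :
    shift x (a • μ) = a • shift x μ := Measure.map_smul _ _ _

theorem measurable_smul_measure (hLam : Measurable Lam)
    (a : ℝ≥0∞) : Measurable fun ω => a • Lam ω :=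
  Measure.measurable_of_measurable_coe _ fun B hB => by
    simpa using ((Measure.measurable_coe hB).comp hLam).const_mul a

theorem LocFin.smul {N : Measure (Space d)} (h : LocFin N) {a : ℝ≥0∞} (ha : a ≠ ∞) :
    LocFin (a • N) := fun n => by
  simpa using ENNReal.mul_lt_top (lt_top_iff_ne_top.mpr ha) (h n)

/-- Scaling acts twice: the integrating measure gives the factor `a`, which later cancels the
normalisation by the intensity, and the shifted measure is scaled inside `h`. -/
theorem lintegral_palm_smul (hLam : Measurable Lam)
    (hfin : ∀ᵐ ω ∂P, LocFin (Lam ω)) {a : ℝ≥0∞} (ha : a ≠ ∞)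
    {h : Measure (Space d) → ℝ≥0∞} (hh : Measurable h) :
    ∫⁻ μ, h μ ∂(palm P fun ω => a • Lam ω) = a * ∫⁻ μ, h (a • μ) ∂(palm P Lam) := by
  have hh' : Measurable fun μ : Measure (Space d) => h (a • μ) :=
    hh.comp (measurable_smul_measure measurable_id a)
  rw [lintegral_palm' (measurable_smul_measure hLam a) (hfin.mono fun ω hω => hω.smul ha) hh,
    lintegral_palm' hLam hfin hh', ← lintegral_const_mul' _ _ ha]
  refine lintegral_congr fun ω => ?_
  simp only [Measure.restrict_smul, lintegral_smul_measure, shift_smul, smul_eq_mul]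

end Stationary

/-! ### Palm versions of Cox processes. -/

section Cox

variable {d : ℕ} {Ω : Type*} [MeasurableSpace Ω] {P : Measure Ω} [IsProbabilityMeasure P]
  {M X : Ω → Measure (Space d)}

theorem IsCoxProcess.exists_kernel (hX : IsCoxProcess P M X) (hM : Measurable M) :
    ∃ κ : Kernel (Measure (Space d)) (Measure (Space d)),
      (∀ g : Measure (Space d) → ℝ≥0∞, Measurable g →
        ∫⁻ N, g N ∂(P.map X) = ∫⁻ μ, ∫⁻ N, g N ∂(κ μ) ∂(P.map M)) ∧
      ∀ᵐ μ ∂(P.map M), IsPoissonProcess μ (κ μ) := by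
  obtain ⟨κ, hκ, h1, h2⟩ := hX.conditional
  have := Measure.isProbabilityMeasure_map (μ := P) hM.aemeasurable
  refine ⟨κ, fun g hg => ?_, h2⟩
  rw [lintegral_map hg hX.measurable,
    ← Measure.lintegral_compProd (f := fun p : Measure (Space d) × Measure (Space d) => g p.2)
      (hg.comp measurable_snd), ← h1,
    lintegral_map (f := fun p : Measure (Space d) × Measure (Space d) => g p.2)
      (hg.comp measurable_snd) (hM.prodMk hX.measurable)]

theorem IsCoxProcess.ae_mem_countingMeasures (hX : IsCoxProcess P M X) (hM : Measurable M)
    (hfin : ∀ᵐ ω ∂P, LocFin (M ω)) : ∀ᵐ ω ∂P, X ω ∈ CountingMeasures d := by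
  obtain ⟨κ, h1, h2⟩ := hX.exists_kernel hM
  have hC := measurableSet_countingMeasures d
  have hfin' : ∀ᵐ μ ∂(P.map M), LocFin μ :=
    (ae_map_iff hM.aemeasurable (measurableSet_locFin d)).mpr hfin
  refine (ae_map_iff hX.measurable.aemeasurable hC).mp ?_
  change P.map X (CountingMeasures d)ᶜ = 0
  rw [← lintegral_indicator_one hC.compl, h1 _ (measurable_one.indicator hC.compl)]
  refine (lintegral_congr_ae ?_).trans lintegral_zero
  filter_upwards [h2, hfin'] with μ hμ1 hμ2
  rw [lintegral_indicator_one hC.compl]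
  exact hμ1.ae_mem_countingMeasures hμ2

theorem IsCoxProcess.palm_void (hX : IsCoxProcess P M X) (hM : Measurable M)
    (hfin : ∀ᵐ ω ∂P, LocFin (M ω)) {S : Set (Space d)} (hS : IsOpen S) :
    palm P X {N | N S = 0} =
      ∫⁻ μ, Sᶜ.indicator 1 (0 : Space d) * voidProb (μ S) ∂(palm P M) := by
  obtain ⟨κ, h1, h2⟩ := hX.exists_kernel hM
  have hfin' : ∀ᵐ μ ∂(P.map M), LocFin μ :=
    (ae_map_iff hM.aemeasurable (measurableSet_locFin d)).mpr hfin
  have hXfin : ∀ᵐ ω ∂P, LocFin (X ω) := (hX.ae_mem_countingMeasures hM hfin).mono fun _ h => h.1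
  have hSm : MeasurableSet {N : Measure (Space d) | N S = 0} :=
    Measure.measurable_coe hS.measurableSet (measurableSet_singleton 0)
  have hh : Measurable fun μ : Measure (Space d) =>
      Sᶜ.indicator 1 (0 : Space d) * voidProb (μ S) :=
    (measurable_voidProb.comp (Measure.measurable_coe hS.measurableSet)).const_mul _
  rw [← lintegral_indicator_one hSm, lintegral_palm hX.measurable hXfin (measurable_one.indicator hSm),
    h1 _ (measurable_lintegral_shift (measurable_one.indicator hSm)), lintegral_palm hM hfin hh]
  refine lintegral_congr_ae ?_
  filter_upwards [h2, hfin'] with μ hμ1 hμ2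
  rw [hμ1.mecke_void hμ2 hS, hμ2.locFinPart_eq]

theorem IsCoxProcess.ae_palm_mem_countingMeasures (hX : IsCoxProcess P M X) (hM : Measurable M)
    (hfin : ∀ᵐ ω ∂P, LocFin (M ω)) : ∀ᵐ N ∂(palm P X), N ∈ CountingMeasures d := by
  have hc := hX.ae_mem_countingMeasures hM hfin
  refine ae_palm hX.measurable (hc.mono fun _ h => h.1) (measurableSet_countingMeasures d) ?_
  filter_upwards [hc] with ω hω
  exact Eventually.of_forall fun x => shift_mem_countingMeasures hω x

/-- A counting measure gives no mass to its non-atoms, so the location moved to the origin is almost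
always a point. -/
theorem IsCoxProcess.ae_palm_zero_mem_points (hX : IsCoxProcess P M X) (hM : Measurable M)
    (hfin : ∀ᵐ ω ∂P, LocFin (M ω)) : ∀ᵐ N ∂(palm P X), (0 : Space d) ∈ points N := by
  have hc := hX.ae_mem_countingMeasures hM hfin
  have hT : MeasurableSet {N : Measure (Space d) | N {0} = 0}ᶜ :=
    (Measure.measurable_coe (measurableSet_singleton 0) (measurableSet_singleton 0)).compl
  refine (ae_palm hX.measurable (hc.mono fun _ h => h.1) hT ?_).mono fun N hN => hN
  filter_upwards [hc] with ω hω
  have h0 : X ω {x | X ω {x} = 0} = 0 := CountingMeasures.measure_eq_zero hω fun x hx => hx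
  filter_upwards [measure_eq_zero_iff_ae_notMem.mp h0] with x hx
  have : {y : Space d | y - x ∈ ({0} : Set (Space d))} = {x} := by
    ext y; simp [sub_eq_zero]
  rw [Set.mem_compl_iff, Set.mem_ofPred_eq, shift_apply _ _ (measurableSet_singleton _), this]
  exact hx

/-- The law of the Palm version of a point process of intensity `lam`. -/
def palmLaw (P : Measure Ω) (X : Ω → Measure (Space d)) (lam : ℝ) : Measure (Measure (Space d)) :=
  (ENNReal.ofReal lam)⁻¹ • palm P X

variable {Lam : Ω → Measure (Space d)} {lam : ℝ}

/-- The formula behind both bounds: given its environment, the Palm version is a Poisson process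
plus a point at the origin, seen here through void events only. -/
theorem palmLaw_void (hLam : Measurable Lam) (hfin : ∀ᵐ ω ∂P, LocFin (Lam ω)) (hlam : 0 < lam)
    (hX : IsCoxProcess P (fun ω => ENNReal.ofReal lam • Lam ω) X)
    {S : Set (Space d)} (hS : IsOpen S) :
    palmLaw P X lam {N | N S = 0} =
      ∫⁻ μ, Sᶜ.indicator 1 (0 : Space d) * voidProb (ENNReal.ofReal lam * μ S) ∂(palm P Lam) := by
  have hh : Measurable fun μ : Measure (Space d) =>
      Sᶜ.indicator 1 (0 : Space d) * voidProb (μ S) :=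
    (measurable_voidProb.comp (Measure.measurable_coe hS.measurableSet)).const_mul _
  rw [palmLaw, Measure.smul_apply, hX.palm_void (measurable_smul_measure hLam _)
    (hfin.mono fun ω hω => hω.smul ENNReal.ofReal_ne_top) hS,
    lintegral_palm_smul hLam hfin ENNReal.ofReal_ne_top hh, smul_eq_mul, ← mul_assoc,
    ENNReal.inv_mul_cancel (by simpa using hlam) ENNReal.ofReal_ne_top, one_mul]
  simp

theorem palmLaw_univ (hLam : Measurable Lam) (hfin : ∀ᵐ ω ∂P, LocFin (Lam ω)) (hlam : 0 < lam)
    (hX : IsCoxProcess P (fun ω => ENNReal.ofReal lam • Lam ω) X)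
    (hpalm : palm P Lam Set.univ = 1) : palmLaw P X lam Set.univ = 1 := by
  have := palmLaw_void hLam hfin hlam hX isOpen_empty
  simpa [voidProb_zero, hpalm] using this

theorem palmLaw_void_le (hLam : Measurable Lam) (hfin : ∀ᵐ ω ∂P, LocFin (Lam ω)) (hlam : 0 < lam)
    (hX : IsCoxProcess P (fun ω => ENNReal.ofReal lam • Lam ω) X)
    (hpalm : palm P Lam Set.univ = 1) {S : Set (Space d)} (hS : IsOpen S) {c : ℝ≥0∞}
    (hc : ∀ᵐ μ ∂(palm P Lam), c ≤ μ S) :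
    palmLaw P X lam {N | N S = 0} ≤ voidProb (ENNReal.ofReal lam * c) := by
  rw [palmLaw_void hLam hfin hlam hX hS]
  calc _ ≤ ∫⁻ _, voidProb (ENNReal.ofReal lam * c) ∂(palm P Lam) := by
        refine lintegral_mono_ae (hc.mono fun μ hμ => ?_)
        refine (mul_le_of_le_one_left' ?_).trans (voidProb_antitone (by gcongr))
        exact Set.indicator_le_self' (by simp) _
    _ = _ := by rw [lintegral_const, hpalm, mul_one]

end Cox

/-! ### Deterministic geometry of clusters and their discretisation. -/

section Geometry

variable {d : ℕ}

/-- The points of `V` that can be reached from the origin by jumps of length less than `r`. -/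
def cluster (r : ℝ) (V : Set (Space d)) : Set (Space d) :=
  {x | Relation.ReflTransGen (fun a b => a ∈ V ∧ b ∈ V ∧ dist a b < r) 0 x}

theorem cluster_subset {r : ℝ} {V : Set (Space d)} (h0 : 0 ∈ V) : cluster r V ⊆ V := by
  intro x hx
  induction hx with
  | refl => exact h0
  | tail _ h _ => exact h.2.1

theorem cluster_step {r : ℝ} {V : Set (Space d)} (h0 : 0 ∈ V) {x y : Space d}
    (hx : x ∈ cluster r V) (hy : y ∈ V) (hxy : dist x y < r) : y ∈ cluster r V :=
  Relation.ReflTransGen.tail hx ⟨cluster_subset h0 hx, hy, hxy⟩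

theorem finite_cluster {r : ℝ} {N : Measure (Space d)} (h0 : 0 ∈ points N)
    (hN : ¬OriginPercolates r N) : (cluster r (points N)).Finite := by
  have hfin : ((gilbertGraph r (points N)).connectedComponentMk ⟨0, h0⟩).supp.Finite := by
    by_contra h
    exact hN ⟨h0, h⟩
  refine (hfin.image Subtype.val).subset fun x hx => ?_
  have : ∃ h : x ∈ points N, (gilbertGraph r (points N)).Reachable ⟨0, h0⟩ ⟨x, h⟩ := by
    induction hx with
    | refl => exact ⟨h0, SimpleGraph.Reachable.refl _⟩
    | @tail a b _ hab ih =>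
      obtain ⟨ha, hreach⟩ := ih
      refine ⟨hab.2.1, ?_⟩
      by_cases hne : a = b
      · subst hne; exact hreach
      · exact hreach.trans (SimpleGraph.Adj.reachable
          ⟨fun h => hne (congrArg Subtype.val h), hab.2.2⟩)
  obtain ⟨h, hreach⟩ := this
  exact ⟨⟨x, h⟩, SimpleGraph.ConnectedComponent.sound hreach.symm, rfl⟩

/-- An edge leaving `A` would end in the empty shell, so the component is trapped in `A`, where
there are finitely many points. -/
theorem not_originPercolates {r : ℝ} {N : Measure (Space d)} (hN : N ∈ CountingMeasures d)
    {A : Set (Space d)} (hA : IsCompact A) (h0A : 0 ∈ A) (hb : N (rBoundary r A) = 0) :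
    ¬OriginPercolates r N := by
  rintro ⟨h0, hinf⟩
  refine hinf ?_
  have hsub : ∀ v : points N, (gilbertGraph r (points N)).Reachable ⟨0, h0⟩ v → v.1 ∈ A := by
    intro v hv
    rw [SimpleGraph.reachable_iff_reflTransGen] at hv
    induction hv with
    | refl => exact h0A
    | @tail a b _ hab ih =>
      by_contra hbA
      have hbB : b.1 ∈ rBoundary r A :=
        ⟨Metric.mem_thickening_iff.mpr ⟨a.1, ih, by rw [dist_comm]; exact hab.2⟩, hbA⟩
      exact b.2 (measure_mono_null (Set.singleton_subset_iff.mpr hbB) hb)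
  refine Set.Finite.of_finite_image ((CountingMeasures.finite_points hN hA.isBounded).subset ?_)
    Subtype.val_injective.injOn
  rintro _ ⟨v, hv, rfl⟩
  exact ⟨v.2, hsub v (SimpleGraph.ConnectedComponent.exact hv).symm⟩

theorem isPreconnected_biUnion_cluster {r : ℝ} {V : Set (Space d)} {B : Space d → Set (Space d)}
    (hB : ∀ p, IsPreconnected (B p)) (hball : ∀ p, Metric.closedBall p (r / 2) ⊆ B p) :
    IsPreconnected (⋃ p ∈ cluster r V, B p) := by
  have hstep : ∀ a b : Space d, dist a b < r → (B a ∩ B b).Nonempty := by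
    intro a b hab
    refine ⟨midpoint ℝ a b, hball a ?_, hball b ?_⟩
    · rw [Metric.mem_closedBall, dist_midpoint_left, Real.norm_ofNat]; linarith
    · rw [Metric.mem_closedBall, dist_midpoint_right, Real.norm_ofNat]; linarith
  set R : Space d → Space d → Prop := fun i j => (B i ∩ B j).Nonempty ∧ i ∈ cluster r V with hR
  have h1 : ∀ x ∈ cluster r V, Relation.ReflTransGen R 0 x ∧ Relation.ReflTransGen R x 0 := by
    intro x hx
    induction hx with
    | refl => exact ⟨Relation.ReflTransGen.refl, Relation.ReflTransGen.refl⟩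
    | @tail a b ha hab ih =>
      refine ⟨ih.1.tail ⟨hstep a b hab.2.2, ha⟩, Relation.ReflTransGen.head ⟨?_, ha.tail hab⟩ ih.2⟩
      rw [Set.inter_comm]; exact hstep a b hab.2.2
  exact IsPreconnected.biUnion_of_reflTransGen (fun p _ => hB p)
    fun x hx y hy => (h1 x hx).2.trans (h1 y hy).1

theorem dist_le_of_forall_abs_sub_le {x y : Space d} {s : ℝ} (hs : 0 ≤ s)
    (h : ∀ i, |x i - y i| ≤ s) : dist x y ≤ √d * s := by
  rw [EuclideanSpace.dist_eq]
  refine Real.sqrt_le_iff.mpr ⟨by positivity, ?_⟩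
  rw [mul_pow, Real.sq_sqrt (by positivity)]
  calc ∑ i, dist (x i) (y i) ^ 2 ≤ ∑ _i : Fin d, s ^ 2 := by
        refine Finset.sum_le_sum fun i _ => pow_le_pow_left₀ dist_nonneg ?_ 2
        rw [Real.dist_eq]; exact h i
    _ = d * s ^ 2 := by simp

/-- The closed cube of side `δ` around the lattice point `δ z`. -/
def closedCube (δ : ℝ) (z : Fin d → ℤ) : Set (Space d) :=
  {y | ∀ i, |y i - δ * z i| ≤ δ / 2}

theorem isClosed_closedCube (δ : ℝ) (z : Fin d → ℤ) : IsClosed (closedCube δ z : Set (Space d)) := by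
  have : (closedCube δ z : Set (Space d)) = ⋂ i, {y | |y i - δ * z i| ≤ δ / 2} := by
    ext; simp [closedCube]
  rw [this]
  exact isClosed_iInter fun i => isClosed_le (by fun_prop) continuous_const

theorem isCompact_closedCube (δ : ℝ) (z : Fin d → ℤ) :
    IsCompact (closedCube δ z : Set (Space d)) := by
  refine Metric.isCompact_of_isClosed_isBounded (isClosed_closedCube δ z)
    ((isBounded_cube δ (WithLp.toLp 2 fun i => δ * (z i : ℝ))).subset fun y hy => hy)

theorem convex_closedCube (δ : ℝ) (z : Fin d → ℤ) :
    Convex ℝ (closedCube δ z : Set (Space d)) := by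
  intro x hx y hy a b ha hb hab i
  have h1 := hx i
  have h2 := hy i
  have : (a • x + b • y) i - δ * z i = a * (x i - δ * z i) + b * (y i - δ * z i) := by
    simp only [PiLp.add_apply, PiLp.smul_apply, smul_eq_mul]
    linear_combination (δ * z i) * hab
  rw [this]
  calc |a * (x i - δ * z i) + b * (y i - δ * z i)|
      ≤ |a * (x i - δ * z i)| + |b * (y i - δ * z i)| := abs_add_le _ _
    _ = a * |x i - δ * z i| + b * |y i - δ * z i| := by
        rw [abs_mul, abs_mul, abs_of_nonneg ha, abs_of_nonneg hb]
    _ ≤ a * (δ / 2) + b * (δ / 2) := by gcongr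
    _ = δ / 2 := by rw [← add_mul, hab, one_mul]

/-- The site whose closed cube contains `x`. -/
def siteOf (δ : ℝ) (x : Space d) : Fin d → ℤ := fun i => round (x i / δ)

theorem mem_closedCube_siteOf {δ : ℝ} (hδ : 0 < δ) (x : Space d) :
    x ∈ closedCube δ (siteOf δ x) := by
  intro i
  have h := abs_sub_round (x i / δ)
  have h2 : x i - δ * (siteOf δ x i : ℝ) = δ * (x i / δ - round (x i / δ)) := by
    simp only [siteOf]; field_simp
  rw [h2, abs_mul, abs_of_pos hδ]
  calc δ * |x i / δ - round (x i / δ)| ≤ δ * (1 / 2) := by gcongr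
    _ = δ / 2 := by ring

theorem kingAdj_of_mem_closedCube {δ : ℝ} (hδ : 0 < δ) {z w : Fin d → ℤ} {x : Space d}
    (hz : x ∈ closedCube δ z) (hw : x ∈ closedCube δ w) : KingAdj z w := by
  intro i
  have h1 := abs_le.mp (hz i)
  have h2 := abs_le.mp (hw i)
  have h3 : δ * |((z i - w i : ℤ) : ℝ)| ≤ δ * 1 := by
    rw [← abs_of_pos hδ, ← abs_mul, abs_of_pos hδ, abs_le]
    push_cast
    constructor <;> nlinarith [h1.1, h1.2, h2.1, h2.2]
  have h4 := le_of_mul_le_mul_left h3 hδ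
  exact_mod_cast h4

/-- The sites whose closed cubes meet `T`. -/
def sitesMeeting (δ : ℝ) (T : Set (Space d)) : Set (Fin d → ℤ) :=
  {z | (closedCube δ z ∩ T).Nonempty}

theorem finite_sitesMeeting {δ : ℝ} (hδ : 0 < δ) {T : Set (Space d)}
    (hT : Bornology.IsBounded T) : (sitesMeeting δ T).Finite := by
  obtain ⟨R, hR⟩ := hT.subset_closedBall (0 : Space d)
  obtain ⟨n, hn⟩ := exists_nat_ge ((R + δ / 2) / δ)
  refine (Finset.finite_toSet (Fintype.piFinset fun _ : Fin d =>
    Finset.Icc (-(n : ℤ)) n)).subset fun z hz => ?_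
  obtain ⟨y, hy1, hy2⟩ := hz
  rw [Finset.mem_coe, Fintype.mem_piFinset]
  intro i
  have h1 := hy1 i
  have h2 : |y i| ≤ R := by
    have h := hR hy2
    rw [mem_closedBall_zero_iff] at h
    have := PiLp.norm_apply_le y i
    rw [Real.norm_eq_abs] at this
    exact this.trans h
  rw [div_le_iff₀ hδ] at hn
  rw [abs_le] at h1 h2
  have h3 : ((z i : ℝ)) ≤ n := le_of_mul_le_mul_left (by linarith [h1.1, h2.2]) hδ
  have h4 : -(n : ℝ) ≤ z i := le_of_mul_le_mul_left (by linarith [h1.2, h2.1]) hδ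
  rw [Finset.mem_Icc]
  exact ⟨by exact_mod_cast h4, by exact_mod_cast h3⟩

/-- Otherwise a lattice component and the remaining sites would cover `T` by two closed unions of
cubes, each meeting `T`. These share a point of `T`, and cubes with a common point have neighbouring
sites. -/
theorem kingConn_sitesMeeting {δ : ℝ} (hδ : 0 < δ) {T : Set (Space d)} (hT : IsPreconnected T)
    (hfin : (sitesMeeting δ T).Finite) {z z' : Fin d → ℤ} (hz : z ∈ sitesMeeting δ T)
    (hz' : z' ∈ sitesMeeting δ T) : KingConn (sitesMeeting δ T) z z' := by
  by_contra hno
  set S := sitesMeeting δ T with hS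
  set Z : Set (Fin d → ℤ) := {w | w ∈ S ∧ KingConn S z w} with hZ
  have hclosed : ∀ U ⊆ S, IsClosed (⋃ w ∈ U, closedCube δ w : Set (Space d)) := fun U hU =>
    (hfin.subset hU).isClosed_biUnion fun w _ => isClosed_closedCube δ w
  have hcov : T ⊆ (⋃ w ∈ Z, closedCube δ w) ∪ ⋃ w ∈ S \ Z, closedCube δ w := by
    intro x hx
    have h1 := mem_closedCube_siteOf hδ x
    have h2 : siteOf δ x ∈ S := ⟨x, h1, hx⟩
    by_cases h3 : siteOf δ x ∈ Z
    · exact Or.inl (Set.mem_biUnion h3 h1)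
    · exact Or.inr (Set.mem_biUnion (show siteOf δ x ∈ S \ Z from ⟨h2, h3⟩) h1)
  obtain ⟨x, hx, hx'⟩ := hz
  obtain ⟨y, hy, hy'⟩ := hz'
  obtain ⟨u, -, hu1, hu2⟩ := isPreconnected_closed_iff.mp hT _ _ (hclosed Z fun w hw => hw.1)
    (hclosed (S \ Z) fun w hw => hw.1) hcov
    ⟨x, hx', Set.mem_biUnion (show z ∈ Z from ⟨⟨x, hx, hx'⟩, Relation.ReflTransGen.refl⟩) hx⟩
    ⟨y, hy', Set.mem_biUnion (show z' ∈ S \ Z from ⟨⟨y, hy, hy'⟩, fun h => hno h.2⟩) hy⟩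
  simp only [Set.mem_iUnion, exists_prop] at hu1 hu2
  obtain ⟨w, hw, hwu⟩ := hu1
  obtain ⟨v, hv, hvu⟩ := hu2
  exact hv.2 ⟨hv.1, hw.2.tail ⟨kingAdj_of_mem_closedCube hδ hwu hvu, hw.1, hv.1⟩⟩

/-- The union of the closed cubes with sites in `Z`. -/
def cubeUnion (δ : ℝ) (Z : Set (Fin d → ℤ)) : Set (Space d) := ⋃ z ∈ Z, closedCube δ z

theorem isCompact_cubeUnion (δ : ℝ) {Z : Set (Fin d → ℤ)} (hZ : Z.Finite) :
    IsCompact (cubeUnion δ Z : Set (Space d)) :=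
  hZ.isCompact_biUnion fun z _ => isCompact_closedCube δ z

theorem zero_mem_closedCube {δ : ℝ} (hδ : 0 < δ) : (0 : Space d) ∈ closedCube δ 0 := by
  intro i; simp; positivity

theorem cubeUnion_mem_rConnected {r δ : ℝ} (hr : 0 < r) (hδ : 0 < δ) {V : Set (Space d)}
    (hfin : (cluster r V).Finite) :
    cubeUnion δ (siteOf δ '' cluster r V) ∈ rConnected d r := by
  have hc := isCompact_cubeUnion δ (hfin.image (siteOf δ))
  have h0 : (0 : Space d) ∈ cubeUnion δ (siteOf δ '' cluster r V) :=
    Set.mem_biUnion (Set.mem_image_of_mem _ Relation.ReflTransGen.refl) (mem_closedCube_siteOf hδ 0)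
  refine ⟨hc, h0, ⟨0, Metric.self_subset_cthickening _ h0⟩, ?_⟩
  have heq : Metric.cthickening (r / 2) (cubeUnion δ (siteOf δ '' cluster r V)) =
      ⋃ p ∈ cluster r V, Metric.cthickening (r / 2) (closedCube δ (siteOf δ p) : Set (Space d)) := by
    rw [hc.cthickening_eq_biUnion_closedBall (by positivity)]
    simp_rw [(isCompact_closedCube δ _).cthickening_eq_biUnion_closedBall
      (show 0 ≤ r / 2 by positivity)]
    simp only [cubeUnion, Set.biUnion_image, Set.biUnion_iUnion]
  rw [heq]
  refine isPreconnected_biUnion_cluster (fun p => ?_) fun p => ?_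
  · exact ((convex_closedCube δ _).cthickening _).isPreconnected
  · exact Metric.closedBall_subset_cthickening (mem_closedCube_siteOf hδ p) _

/-- Rounding to cubes costs at most the diameter `√d * δ`: a point within `t` of the union is within
`r` of the cluster, hence belongs to it, and so its cube is already in the union. -/
theorem measure_rBoundary_cubeUnion {r t δ : ℝ} (hδ : 0 < δ) (ht : t + √d * δ ≤ r)
    {N : Measure (Space d)} (hN : N ∈ CountingMeasures d) (h0 : 0 ∈ points N) :
    N (rBoundary t (cubeUnion δ (siteOf δ '' cluster r (points N)))) = 0 := by
  refine CountingMeasures.measure_eq_zero hN fun x hx => ?_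
  by_contra hx0
  obtain ⟨y, hy, hxy⟩ := Metric.mem_thickening_iff.mp hx.1
  simp only [cubeUnion, Set.biUnion_image, Set.mem_iUnion, exists_prop] at hy
  obtain ⟨p, hp, hyp⟩ := hy
  have h1 := mem_closedCube_siteOf hδ p
  have h2 : dist y p ≤ √d * δ := dist_le_of_forall_abs_sub_le hδ.le fun i => by
    have e1 := abs_le.mp (hyp i)
    have e2 := abs_le.mp (h1 i)
    rw [abs_le]; constructor <;> linarith [e1.1, e1.2, e2.1, e2.2]
  have h3 : dist p x < r := by
    rw [dist_comm]
    exact (dist_triangle x y p).trans_lt (by linarith)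
  have h4 := cluster_step h0 hp hx0 h3
  exact hx.2 (Set.mem_biUnion (Set.mem_image_of_mem _ h4) (mem_closedCube_siteOf hδ x))

/-- If the cluster of the origin is finite, then either it is confined to a box and isolated there,
or there is a long path of empty cubes. -/
theorem isolated_or_empty_path (hd : 2 ≤ d) {r t δ : ℝ} (hr : 0 < r) (hδ : 0 < δ)
    (ht : t + √d * δ ≤ r) (hδr : √d * (2 * δ) < r / 2) {N : Measure (Space d)}
    (hN : N ∈ CountingMeasures d) (h0 : 0 ∈ points N) (hperc : ¬OriginPercolates r N) (n : ℕ) :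
    (∃ Z : Set (Fin d → ℤ), (∀ z ∈ Z, ∀ i, |z i| < 2 * n) ∧ cubeUnion δ Z ∈ rConnected d r ∧
      N (rBoundary t (cubeUnion δ Z)) = 0) ∨
    ∃ k, n ≤ k ∧ ∃ a ≤ k, ∃ p : ℕ → Fin d → ℤ, p 0 = shiftSite ⟨0, by omega⟩ a 0 ∧
      (∀ j, KingAdj (p j) (p (j + 1))) ∧ Set.InjOn p (Set.Iic k) ∧
      ∀ j, N (openCube δ (p j)) = 0 := by
  have hfin := finite_cluster h0 hperc
  set K := cluster r (points N) with hK
  have h0K : (0 : Space d) ∈ K := Relation.ReflTransGen.refl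
  set T : Set (Space d) := ⋃ p ∈ K, Metric.closedBall p (r / 2) with hT
  have hTb : Bornology.IsBounded T :=
    (Bornology.isBounded_biUnion hfin).mpr fun p _ => Metric.isBounded_closedBall
  have hTc : IsPreconnected T := isPreconnected_biUnion_cluster
    (fun p => (convex_closedBall p _).isPreconnected) fun p => subset_rfl
  have hKT : K ⊆ T := fun p hp => Set.mem_biUnion hp (Metric.mem_closedBall_self (by positivity))
  have hSfin := finite_sitesMeeting hδ hTb
  -- The dichotomy uses the cubes meeting the `r / 2`-thickened cluster `T`: the cluster itself is
  -- discrete, while `T` is connected and so are its sites.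
  by_cases hfar : ∃ z ∈ sitesMeeting δ T, ∃ i, 2 * (n : ℤ) ≤ |z i|
  · right
    obtain ⟨k, hk, a, ha, p, hp0, hpC, hpa, hpi⟩ := exists_boundary_path hd hSfin
      (fun x hx y hy => kingConn_sitesMeeting hδ hTc hSfin hx hy)
      ⟨0, zero_mem_closedCube hδ, hKT h0K⟩ n hfar
    refine ⟨k, hk, a, ha, p, hp0, hpa, hpi, fun j => ?_⟩
    -- A point in a boundary cube is within `√d * (2 * δ) < r / 2` of `T`, hence within `r` of the
    -- cluster. It then joins the cluster, and its cube meets `T` after all.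
    by_contra hj
    obtain ⟨x, hx, hxN⟩ := CountingMeasures.exists_point hN hj
    obtain ⟨hout, c, ⟨y, hyc, hyT⟩, hadj⟩ := hpC j
    simp only [hT, Set.mem_iUnion, exists_prop] at hyT
    obtain ⟨q, hq, hyq⟩ := hyT
    have h1 : dist x y ≤ √d * (2 * δ) := dist_le_of_forall_abs_sub_le (by positivity) fun i => by
      have e1 := abs_lt.mp (hx i)
      have e2 := abs_le.mp (hyc i)
      have e3 : |((c i - p j i : ℤ) : ℝ)| ≤ 1 := by exact_mod_cast hadj i
      rw [abs_le] at e3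
      push_cast at e3
      rw [abs_le]
      constructor <;> nlinarith [e1.1, e1.2, e2.1, e2.2, e3.1, e3.2]
    have h2 : dist q x < r := by
      rw [dist_comm]
      have := dist_triangle x y q
      rw [Metric.mem_closedBall] at hyq
      linarith
    have h3 := cluster_step h0 hq hxN h2
    exact hout ⟨x, fun i => (hx i).le, hKT h3⟩
  · left
    push Not at hfar
    refine ⟨siteOf δ '' K, ?_, cubeUnion_mem_rConnected hr hδ hfin,
      measure_rBoundary_cubeUnion hδ ht hN h0⟩
    rintro _ ⟨p, hp, rfl⟩ i
    exact hfar _ ⟨p, mem_closedCube_siteOf hδ p, hKT hp⟩ i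

end Geometry

/-! ### Constant prefactors vanish on the logarithmic scale. -/

section Asymptotics

theorem log_div_eq {C K lam : ℝ} (hC : 0 < C) (hlam : 0 < lam) :
    ENNReal.log (ENNReal.ofReal (C * Real.exp (-(lam * K)))) / (lam : EReal) =
      ((Real.log C / lam - K : ℝ) : EReal) := by
  rw [ENNReal.log_ofReal_of_pos (by positivity), Real.log_mul hC.ne' (Real.exp_pos _).ne',
    Real.log_exp, ← EReal.coe_div]
  congr 1
  field_simp
  ring

theorem tendsto_log_div {C : ℝ} (hC : 0 < C) (K : ℝ) :
    Tendsto (fun lam : ℝ => ENNReal.log (ENNReal.ofReal (C * Real.exp (-(lam * K)))) / (lam : EReal))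
      atTop (𝓝 ((-K : ℝ) : EReal)) := by
  have h : Tendsto (fun lam : ℝ => Real.log C / lam - K) atTop (𝓝 (0 - K)) :=
    (tendsto_const_nhds.div_atTop tendsto_id).sub tendsto_const_nhds
  rw [zero_sub] at h
  refine (EReal.tendsto_coe.mpr h).congr' ?_
  filter_upwards [eventually_gt_atTop 0] with lam hlam using (log_div_eq hC hlam).symm

theorem limsup_log_div_le {u : ℝ → ℝ≥0∞} {C K : ℝ} (hC : 0 < C)
    (hu : ∀ᶠ lam in atTop, u lam ≤ ENNReal.ofReal (C * Real.exp (-(lam * K)))) :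
    limsup (fun lam : ℝ => ENNReal.log (u lam) / (lam : EReal)) atTop ≤ ((-K : ℝ) : EReal) := by
  rw [← (tendsto_log_div hC K).limsup_eq]
  refine limsup_le_limsup ?_
  filter_upwards [hu, eventually_ge_atTop 0] with lam h1 h2
  exact EReal.div_le_div_right_of_nonneg (by exact_mod_cast h2) (ENNReal.log_le_log h1)

theorem le_liminf_log_div {u : ℝ → ℝ≥0∞} {C K : ℝ} (hC : 0 < C)
    (hu : ∀ᶠ lam in atTop, ENNReal.ofReal (C * Real.exp (-(lam * K))) ≤ u lam) :
    ((-K : ℝ) : EReal) ≤ liminf (fun lam : ℝ => ENNReal.log (u lam) / (lam : EReal)) atTop := by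
  rw [← (tendsto_log_div hC K).liminf_eq]
  refine liminf_le_liminf ?_
  filter_upwards [hu, eventually_ge_atTop 0] with lam h1 h2
  exact EReal.div_le_div_right_of_nonneg (by exact_mod_cast h2) (ENNReal.log_le_log h1)

end Asymptotics

/-! ### Monotonicity of the isolation cost. -/

section Cost

variable {d : ℕ}

/-- The larger thickening is the smaller one, which is connected, with balls attached to it at their
centres in `A`. -/
theorem rConnected_mono {s t : ℝ} (hst : s ≤ t) : rConnected d s ⊆ rConnected d t := by
  rintro A ⟨hA, h0, hc⟩
  refine ⟨hA, h0, ?_⟩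
  have hsub : Metric.cthickening (s / 2) A ⊆ Metric.cthickening (t / 2) A :=
    Metric.cthickening_mono (by linarith) A
  have h0' := Metric.self_subset_cthickening (δ := s / 2) A h0
  -- For radii at most zero both thickenings are the closure of `A`.
  rcases le_or_gt t 0 with ht | ht
  · rwa [Metric.cthickening_of_nonpos (by linarith), ← Metric.cthickening_of_nonpos
      (show s / 2 ≤ 0 by linarith)]
  · refine ⟨⟨0, hsub h0'⟩, isPreconnected_of_forall 0 fun y hy => ?_⟩
    rw [hA.cthickening_eq_biUnion_closedBall (by positivity)] at hy
    obtain ⟨a, ha, hya⟩ := Set.mem_iUnion₂.mp hy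
    have haT := Metric.self_subset_cthickening (δ := s / 2) A ha
    refine ⟨Metric.cthickening (s / 2) A ∪ Metric.closedBall a (t / 2), Set.union_subset hsub
      (Metric.closedBall_subset_cthickening ha _), Or.inl h0', Or.inr hya, ?_⟩
    exact hc.isPreconnected.union a haT (Metric.mem_closedBall_self (by positivity))
      (convex_closedBall a _).isPreconnected

theorem rBoundary_mono {s t : ℝ} (hst : s ≤ t) (A : Set (Space d)) :
    rBoundary s A ⊆ rBoundary t A :=
  Set.sdiff_subset_sdiff_left (Metric.thickening_mono hst A)

theorem isOpen_rBoundary (t : ℝ) {A : Set (Space d)} (hA : IsCompact A) :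
    IsOpen (rBoundary t A) :=
  Metric.isOpen_thickening.sdiff hA.isClosed

/-- As `ε` grows there are more competitors `A` and thinner shells. Hence the limit at `0` from the
right exists and is a supremum. -/
theorem antitone_isolationCost {Ω : Type*} [MeasurableSpace Ω] (P : Measure Ω)
    (Lam : Ω → Measure (Space d)) (r : ℝ) :
    Antitone fun ε : ℝ => isolationCost P Lam (r + ε) (r - ε) := by
  intro ε ε' h
  refine le_iInf₂ fun A hA => (iInf₂_le A (rConnected_mono (by linarith) hA)).trans ?_
  exact essInf_mono_ae (Eventually.of_forall fun μ => measure_mono (rBoundary_mono (by linarith) A))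

end Cost

/-! ### Bounds on the probability of a finite cluster. -/

section Bounds

variable {d : ℕ} {Ω : Type*} [MeasurableSpace Ω] {P : Measure Ω} [IsProbabilityMeasure P]
  {Lam X : Ω → Measure (Space d)} {lam : ℝ}

theorem lintegral_voidProb_le (hLam : Measurable Lam) (hfin : ∀ᵐ ω ∂P, LocFin (Lam ω))
    (hpalm : palm P Lam Set.univ = 1) (hlam : 0 < lam)
    (hX : IsCoxProcess P (fun ω => ENNReal.ofReal lam • Lam ω) X) {r : ℝ} {A : Set (Space d)}
    (hA : IsCompact A) (h0 : 0 ∈ A) :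
    ∫⁻ μ, voidProb (ENNReal.ofReal lam * μ (rBoundary r A)) ∂(palm P Lam) ≤
      1 - percProb P X lam r := by
  have hS := isOpen_rBoundary r hA
  have hm := measurable_smul_measure hLam (ENNReal.ofReal lam)
  have hf := hfin.mono fun ω hω => hω.smul (ENNReal.ofReal_ne_top (r := lam))
  have hvoid := palmLaw_void hLam hfin hlam hX hS
  rw [Set.indicator_of_mem (show (0 : Space d) ∈ (rBoundary r A)ᶜ from fun h => h.2 h0)] at hvoid
  simp only [Pi.one_apply, one_mul] at hvoid
  rw [← hvoid]
  have huniv := palmLaw_univ hLam hfin hlam hX hpalm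
  have hSm : MeasurableSet {N : Measure (Space d) | N (rBoundary r A) = 0} :=
    Measure.measurable_coe hS.measurableSet (measurableSet_singleton 0)
  have hc : ∀ᵐ N ∂(palmLaw P X lam), N ∈ CountingMeasures d :=
    Measure.ae_smul_measure (hX.ae_palm_mem_countingMeasures hm hf) _
  -- Percolation is compared with a measurable void event, so its own measurability is never
  -- required.
  have hle : percProb P X lam r ≤
      palmLaw P X lam {N : Measure (Space d) | N (rBoundary r A) = 0}ᶜ := by
    refine measure_mono_ae ?_
    filter_upwards [hc] with N hN hperc hN0
    exact not_originPercolates hN hA h0 hN0 hperc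
  refine ENNReal.le_sub_of_add_le_right
    (ne_top_of_le_ne_top (b := palmLaw P X lam Set.univ) (by rw [huniv]; exact ENNReal.one_ne_top)
      (measure_mono (Set.subset_univ _))) ?_
  calc _ ≤ _ + palmLaw P X lam {N : Measure (Space d) | N (rBoundary r A) = 0}ᶜ :=
        add_le_add_right hle _
    _ = 1 := by rw [measure_add_measure_compl hSm, huniv]

/-- The lattice path that starts at distance `a` from the origin and has increments `s`. -/
def latticePath (o : Fin d) (a : ℕ) {k : ℕ} (s : Fin k → Fin d → Fin 3) (j : ℕ) : Fin d → ℤ :=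
  fun i => shiftSite o a 0 i + ∑ l ∈ Finset.range j,
    if h : l < k then ((s ⟨l, h⟩ i : ℕ) : ℤ) - 1 else 0

theorem exists_latticePath (o : Fin d) (a k : ℕ) {p : ℕ → Fin d → ℤ} (h0 : p 0 = shiftSite o a 0)
    (hp : ∀ j, KingAdj (p j) (p (j + 1))) :
    ∃ s : Fin k → Fin d → Fin 3, ∀ j ≤ k, latticePath o a s j = p j := by
  have hb : ∀ j i, 0 ≤ p (j + 1) i - p j i + 1 ∧ p (j + 1) i - p j i + 1 < 3 := by
    intro j i
    have := abs_le.mp (hp j i)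
    omega
  refine ⟨fun l i => ⟨(p (l + 1) i - p l i + 1).toNat, by have := hb l i; omega⟩, ?_⟩
  intro j
  induction j with
  | zero => intro _; funext i; simp [latticePath, h0]
  | succ j ih =>
    intro hj
    have ih' := ih (by omega)
    funext i
    have e := congrFun ih' i
    simp only [latticePath] at e ⊢
    rw [Finset.sum_range_succ, ← add_assoc, e, dif_pos (by omega)]
    rw [Int.toNat_of_nonneg (hb j i).1]
    ring

theorem disjoint_openCube {δ : ℝ} {z w : Fin d → ℤ} (hzw : z ≠ w) :
    Disjoint (openCube δ z : Set (Space d)) (openCube δ w) := by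
  rw [Set.disjoint_left]
  intro y hz hw
  refine hzw (funext fun i => ?_)
  have h1 := abs_lt.mp (hz i)
  have h2 := abs_lt.mp (hw i)
  have hδ : 0 < δ := by linarith [h1.1, h1.2]
  have h3 : ((z i - w i : ℤ) : ℝ) < 1 := by push_cast; nlinarith [h1.1, h1.2, h2.1, h2.2]
  have h4 : (-1 : ℝ) < ((z i - w i : ℤ) : ℝ) := by push_cast; nlinarith [h1.1, h1.2, h2.1, h2.2]
  have h5 : z i - w i < 1 := by exact_mod_cast h3
  have h6 : -1 < z i - w i := by exact_mod_cast h4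
  omega

/-- A self-avoiding path visits `k + 1` disjoint cubes of mass at least `c` each. Injectivity is
part of the event, so that the union bound can run over all increment sequences: the others
contribute the empty event. -/
theorem palmLaw_latticePath_le (hLam : Measurable Lam) (hfin : ∀ᵐ ω ∂P, LocFin (Lam ω))
    (hpalm : palm P Lam Set.univ = 1) (hlam : 0 < lam)
    (hX : IsCoxProcess P (fun ω => ENNReal.ofReal lam • Lam ω) X) {δ c : ℝ} (hc : 0 < c)
    (hcube : ∀ᵐ μ ∂(palm P Lam), ∀ z : Fin d → ℤ, ENNReal.ofReal c ≤ μ (openCube δ z))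
    (k : ℕ) (p : ℕ → Fin d → ℤ) :
    palmLaw P X lam {N | Set.InjOn p (Set.Iic k) ∧
      N (⋃ j ∈ Finset.range (k + 1), openCube δ (p j)) = 0} ≤
      ENNReal.ofReal (Real.exp (-(lam * (c * (k + 1))))) := by
  by_cases hp : Set.InjOn p (Set.Iic k)
  · have hS : IsOpen (⋃ j ∈ Finset.range (k + 1), openCube δ (p j) : Set (Space d)) :=
      isOpen_biUnion fun j _ => isOpen_openCube δ _
    have hle := palmLaw_void_le hLam hfin hlam hX hpalm hS
      (c := ENNReal.ofReal (c * (k + 1))) (by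
        filter_upwards [hcube] with μ hμ
        rw [measure_biUnion_finset _ fun j _ => (isOpen_openCube δ _).measurableSet]
        · calc ENNReal.ofReal (c * (k + 1)) = ∑ _j ∈ Finset.range (k + 1), ENNReal.ofReal c := by
                rw [Finset.sum_const, Finset.card_range, nsmul_eq_mul, mul_comm,
                  ENNReal.ofReal_mul (by positivity)]
                congr 1
                rw [← ENNReal.ofReal_natCast]; push_cast; rfl
            _ ≤ _ := Finset.sum_le_sum fun j _ => hμ (p j)
        · intro i hi j hj hij
          refine disjoint_openCube fun h => hij (hp ?_ ?_ h)
          · have := Finset.mem_range.mp hi; exact Nat.lt_succ_iff.mp this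
          · have := Finset.mem_range.mp hj; exact Nat.lt_succ_iff.mp this)
    rw [← ENNReal.ofReal_mul hlam.le, voidProb_ofReal (by positivity)] at hle
    simpa [hp] using hle
  · simp [hp]

/-- The event that there is a path of at least `n + 1` empty cubes which starts close to the
origin. -/
def emptyPathEvent (δ : ℝ) (o : Fin d) (n : ℕ) : Set (Measure (Space d)) :=
  {N | ∃ k, n ≤ k ∧ ∃ a ≤ k, ∃ p : ℕ → Fin d → ℤ, p 0 = shiftSite o a 0 ∧
      (∀ j, KingAdj (p j) (p (j + 1))) ∧ Set.InjOn p (Set.Iic k) ∧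
      ∀ j, N (openCube δ (p j)) = 0}

theorem palmLaw_paths_le (hLam : Measurable Lam) (hfin : ∀ᵐ ω ∂P, LocFin (Lam ω))
    (hpalm : palm P Lam Set.univ = 1) (hlam : 0 < lam)
    (hX : IsCoxProcess P (fun ω => ENNReal.ofReal lam • Lam ω) X) {δ c : ℝ} (hc : 0 < c)
    (hcube : ∀ᵐ μ ∂(palm P Lam), ∀ z : Fin d → ℤ, ENNReal.ofReal c ≤ μ (openCube δ z))
    (o : Fin d) (n : ℕ) :
    palmLaw P X lam (emptyPathEvent δ o n) ≤
    ∑' m : ℕ, ENNReal.ofReal (((n + m : ℕ) + 1) * (3 ^ d) ^ (n + m) *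
      Real.exp (-(lam * (c * ((n + m : ℕ) + 1))))) := by
  have hsub : emptyPathEvent δ o n ⊆
      ⋃ m : ℕ, ⋃ q : Fin (n + m + 1) × (Fin (n + m) → Fin d → Fin 3),
        {N | Set.InjOn (latticePath o q.1 q.2) (Set.Iic (n + m)) ∧
          N (⋃ j ∈ Finset.range (n + m + 1), openCube δ (latticePath o q.1 q.2 j)) = 0} := by
    rintro N ⟨k, hk, a, ha, p, hp0, hpa, hpi, hpN⟩
    obtain ⟨m, rfl⟩ := Nat.exists_eq_add_of_le hk
    obtain ⟨s, hs⟩ := exists_latticePath o a (n + m) hp0 hpa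
    refine Set.mem_iUnion.mpr ⟨m, Set.mem_iUnion.mpr ⟨(⟨a, by omega⟩, s), ?_, ?_⟩⟩
    · exact hpi.congr fun j hj => (hs j hj).symm
    · refine (measure_biUnion_null_iff (Finset.countable_toSet _)).mpr fun j hj => ?_
      have hj' : j < n + m + 1 := by simpa using hj
      simp only
      rw [hs j (by omega)]
      exact hpN j
  refine (measure_mono hsub).trans ((measure_iUnion_le _).trans
    (ENNReal.tsum_le_tsum fun m => ?_))
  refine (measure_iUnion_fintype_le _ _).trans ((Finset.sum_le_sum fun q _ =>
    palmLaw_latticePath_le hLam hfin hpalm hlam hX hc hcube (n + m) _).trans_eq ?_)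
  rw [Finset.sum_const, Finset.card_univ, nsmul_eq_mul, ENNReal.ofReal_mul (by positivity)]
  congr 1
  rw [← ENNReal.ofReal_natCast]
  congr 1
  simp

theorem tsum_paths_le (d n : ℕ) {c : ℝ} (hc : 0 < c) : ∃ lam₀ : ℝ, ∃ C : ℝ, 0 < C ∧
    ∀ lam, lam₀ ≤ lam → ∑' m : ℕ, ENNReal.ofReal (((n + m : ℕ) + 1) * (3 ^ d) ^ (n + m) *
      Real.exp (-(lam * (c * ((n + m : ℕ) + 1))))) ≤
      ENNReal.ofReal (C * Real.exp (-(lam * (c * n)))) := by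
  -- Chosen so that each step costs `1 / (4 * 3 ^ d)`: this absorbs the `3 ^ d` increments and a
  -- factor `2` per step for the `k + 1` starting sites, leaving the ratio `1 / 2`.
  set lam₀ : ℝ := Real.log (4 * 3 ^ d) / c with hlam₀
  refine ⟨lam₀, 2 * Real.exp (lam₀ * (c * n)), by positivity, fun lam hlam => ?_⟩
  have hq : Real.exp (-(lam₀ * c)) = (4 * 3 ^ d)⁻¹ := by
    rw [hlam₀, div_mul_cancel₀ _ hc.ne', Real.exp_neg, Real.exp_log (by positivity)]
  have hterm : ∀ m : ℕ, ((n + m : ℕ) + 1) * (3 ^ d) ^ (n + m) *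
      Real.exp (-(lam * (c * ((n + m : ℕ) + 1)))) ≤
      (1 / 2) ^ m * (Real.exp (lam₀ * (c * n)) * Real.exp (-(lam * (c * n)))) := by
    intro m
    set k := n + m with hk
    have h1 : ((k : ℕ) + 1 : ℝ) ≤ 2 ^ k := by exact_mod_cast Nat.lt_two_pow_self (n := k)
    -- The first `n` steps keep the full rate `lam`; the others are weakened to `lam₀` to sum the
    -- geometric series.
    have h2 : Real.exp (-(lam * (c * (k + 1)))) ≤
        Real.exp (-(lam₀ * c)) ^ k * (Real.exp (lam₀ * (c * n)) * Real.exp (-(lam * (c * n)))) := by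
      rw [← Real.exp_nat_mul, ← Real.exp_add, ← Real.exp_add, Real.exp_le_exp]
      have hnk : (n : ℝ) ≤ k := by exact_mod_cast Nat.le_add_right n m
      have hlam₀0 : 0 ≤ lam₀ := div_nonneg (Real.log_nonneg (by
        have : (1 : ℝ) ≤ 3 ^ d := one_le_pow₀ (by norm_num)
        linarith)) hc.le
      have e1 : 0 ≤ (lam - lam₀) * (c * (k + 1 - n)) :=
        mul_nonneg (by linarith) (mul_nonneg hc.le (by linarith))
      have e2 : 0 ≤ lam₀ * c := by positivity
      nlinarith
    calc ((k : ℕ) + 1) * (3 ^ d) ^ k * Real.exp (-(lam * (c * (k + 1))))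
        ≤ 2 ^ k * (3 ^ d) ^ k * (Real.exp (-(lam₀ * c)) ^ k *
          (Real.exp (lam₀ * (c * n)) * Real.exp (-(lam * (c * n))))) := by gcongr
      _ = (1 / 2) ^ k * (Real.exp (lam₀ * (c * n)) * Real.exp (-(lam * (c * n)))) := by
          rw [← mul_assoc, hq, ← mul_pow, ← mul_pow]
          congr 2
          field_simp
          norm_num
      _ ≤ _ := by
          gcongr ?_ * _
          exact pow_le_pow_of_le_one (by norm_num) (by norm_num) (Nat.le_add_left m n)
  calc _ ≤ ∑' m : ℕ, ENNReal.ofReal ((1 / 2) ^ m *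
        (Real.exp (lam₀ * (c * n)) * Real.exp (-(lam * (c * n))))) :=
        ENNReal.tsum_le_tsum fun m => ENNReal.ofReal_le_ofReal (hterm m)
    _ = ENNReal.ofReal (∑' m : ℕ, (1 / 2) ^ m *
        (Real.exp (lam₀ * (c * n)) * Real.exp (-(lam * (c * n))))) :=
        (ENNReal.ofReal_tsum_of_nonneg (fun m => by positivity)
          (summable_geometric_two.mul_right _)).symm
    _ = _ := by rw [tsum_mul_right, tsum_geometric_two, mul_assoc]

/-- The sites at sup-distance at most `n` from the origin. -/
def siteBox (d n : ℕ) : Finset (Fin d → ℤ) := Fintype.piFinset fun _ => Finset.Icc (-(n : ℤ)) n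

theorem subset_siteBox {n : ℕ} {Z : Set (Fin d → ℤ)} (hZ : ∀ z ∈ Z, ∀ i, |z i| < 2 * n) :
    ∃ F ∈ (siteBox d (2 * n)).powerset, (F : Set (Fin d → ℤ)) = Z := by
  classical
  have hZb : ∀ z ∈ Z, z ∈ siteBox d (2 * n) := fun z hz => by
    rw [siteBox, Fintype.mem_piFinset]
    intro i
    have := abs_lt.mp (hZ z hz i)
    rw [Finset.mem_Icc]
    push_cast
    omega
  refine ⟨(siteBox d (2 * n)).filter fun z => z ∈ Z,
    Finset.mem_powerset.mpr (Finset.filter_subset _ _), ?_⟩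
  ext z
  simp only [Finset.coe_filter, Set.mem_ofPred_eq]
  exact ⟨fun h => h.2, fun h => ⟨hZb z h, h⟩⟩

/-- The event that a union of cubes in a box around the origin is isolated. -/
def isolatedEvent (δ r t : ℝ) (n : ℕ) : Set (Measure (Space d)) :=
  ⋃ F ∈ (siteBox d (2 * n)).powerset, {N | cubeUnion δ (F : Set (Fin d → ℤ)) ∈ rConnected d r ∧
    N (rBoundary t (cubeUnion δ (F : Set (Fin d → ℤ)))) = 0}

theorem palmLaw_isolatedEvent_le (hLam : Measurable Lam)
    (hfin : ∀ᵐ ω ∂P, LocFin (Lam ω)) (hpalm : palm P Lam Set.univ = 1) (hlam : 0 < lam)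
    (hX : IsCoxProcess P (fun ω => ENNReal.ofReal lam • Lam ω) X) {δ r ε : ℝ}
    (hε : 0 ≤ ε) (n : ℕ) {K : ℝ} (hK0 : 0 ≤ K)
    (hK : ENNReal.ofReal K ≤ isolationCost P Lam (r + ε) (r - ε)) :
    palmLaw P X lam (isolatedEvent δ r (r - ε) n) ≤
      ENNReal.ofReal ((siteBox d (2 * n)).powerset.card * Real.exp (-(lam * K))) := by
  refine (measure_biUnion_finset_le _ _).trans ?_
  calc ∑ F ∈ (siteBox d (2 * n)).powerset, palmLaw P X lam
        {N | cubeUnion δ (F : Set (Fin d → ℤ)) ∈ rConnected d r ∧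
          N (rBoundary (r - ε) (cubeUnion δ (F : Set (Fin d → ℤ)))) = 0}
      ≤ ∑ _F ∈ (siteBox d (2 * n)).powerset, ENNReal.ofReal (Real.exp (-(lam * K))) := by
        refine Finset.sum_le_sum fun F _ => ?_
        by_cases hFr : cubeUnion δ (F : Set (Fin d → ℤ)) ∈ rConnected d r
        · have h2 := hK.trans (iInf₂_le _ (rConnected_mono (by linarith : r ≤ r + ε) hFr))
          have hle := palmLaw_void_le hLam hfin hlam hX hpalm
            (isOpen_rBoundary (r - ε) hFr.1) (c := ENNReal.ofReal K)
            (Eventually.mono ae_essInf_le fun μ hμ => h2.trans hμ)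
          rw [← ENNReal.ofReal_mul hlam.le, voidProb_ofReal (by positivity)] at hle
          exact (measure_mono fun N hN => hN.2).trans hle
        · exact (measure_mono_null (fun N hN => hFr hN.1) measure_empty).trans_le zero_le
    _ = ENNReal.ofReal ((siteBox d (2 * n)).powerset.card * Real.exp (-(lam * K))) := by
        rw [Finset.sum_const, nsmul_eq_mul, ENNReal.ofReal_mul (Nat.cast_nonneg _),
          ENNReal.ofReal_natCast]

theorem one_sub_percProb_le (hd : 2 ≤ d) (hLam : Measurable Lam)
    (hfin : ∀ᵐ ω ∂P, LocFin (Lam ω)) (hpalm : palm P Lam Set.univ = 1) (hlam : 0 < lam)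
    (hX : IsCoxProcess P (fun ω => ENNReal.ofReal lam • Lam ω) X) {δ c : ℝ} (hc : 0 < c)
    (hcube : ∀ᵐ μ ∂(palm P Lam), ∀ z : Fin d → ℤ, ENNReal.ofReal c ≤ μ (openCube δ z))
    {r ε : ℝ} (hr : 0 < r) (hε : 0 < ε) (hδ : 0 < δ) (hδε : √d * δ ≤ ε)
    (hδr : √d * (2 * δ) < r / 2) (n : ℕ) {K : ℝ} (hK0 : 0 ≤ K)
    (hK : ENNReal.ofReal K ≤ isolationCost P Lam (r + ε) (r - ε)) :
    1 - percProb P X lam r ≤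
      ENNReal.ofReal ((siteBox d (2 * n)).powerset.card * Real.exp (-(lam * K))) +
      ∑' m : ℕ, ENNReal.ofReal (((n + m : ℕ) + 1) * (3 ^ d) ^ (n + m) *
        Real.exp (-(lam * (c * ((n + m : ℕ) + 1))))) := by
  classical
  have hm := measurable_smul_measure hLam (ENNReal.ofReal lam)
  have hf := hfin.mono fun ω hω => hω.smul (ENNReal.ofReal_ne_top (r := lam))
  have huniv := palmLaw_univ hLam hfin hlam hX hpalm
  -- Subadditivity alone suffices, without measurability of the percolation event.
  have h1 : 1 - percProb P X lam r ≤ palmLaw P X lam {N | OriginPercolates r N}ᶜ := by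
    rw [tsub_le_iff_left, ← huniv, ← Set.union_compl_self {N | OriginPercolates r N}]
    exact measure_union_le _ _
  have hae : ∀ᵐ N ∂(palmLaw P X lam), N ∈ CountingMeasures d ∧ (0 : Space d) ∈ points N :=
    Measure.ae_smul_measure ((hX.ae_palm_mem_countingMeasures hm hf).and
      (hX.ae_palm_zero_mem_points hm hf)) _
  have hsub : ∀ᵐ N ∂(palmLaw P X lam), N ∈ {N | OriginPercolates r N}ᶜ →
      N ∈ isolatedEvent δ r (r - ε) n ∪ emptyPathEvent δ ⟨0, by omega⟩ n := by
    filter_upwards [hae] with N hN hperc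
    rcases isolated_or_empty_path hd hr hδ (by linarith : r - ε + √d * δ ≤ r) hδr hN.1 hN.2
      hperc n with ⟨Z, hZ, hZr, hZN⟩ | h
    · left
      obtain ⟨F, hF, rfl⟩ := subset_siteBox hZ
      exact Set.mem_iUnion₂.mpr ⟨F, hF, hZr, hZN⟩
    · exact Or.inr h
  exact h1.trans ((measure_mono_ae hsub).trans ((measure_union_le _ _).trans (add_le_add
    (palmLaw_isolatedEvent_le hLam hfin hpalm hlam hX hε.le n hK0 hK)
    (palmLaw_paths_le hLam hfin hpalm hlam hX hc hcube _ n))))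

end Bounds

end CoxPerc

end

/-! ### The two large deviation bounds. -/

theorem theorem2p4 {d : ℕ} {Ω : Type*} [MeasurableSpace Ω] (P : Measure Ω)
    [IsProbabilityMeasure P]
    (Lam : Ω → Measure (CoxPerc.Space d)) (hLam : Measurable Lam)
    (hstat : CoxPerc.IsStationary P Lam)
    (hint : ∫⁻ ω, Lam ω (CoxPerc.unitCube d) ∂P = 1)
    (X : ℝ → Ω → Measure (CoxPerc.Space d))
    (hX : ∀ lam : ℝ, 0 < lam →
      CoxPerc.IsCoxProcess P (fun ω => ENNReal.ofReal lam • Lam ω) (X lam))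
    (r : ℝ) (hr : 0 < r) :
    (-(CoxPerc.isolationCost P Lam r r : EReal) ≤
      liminf (fun lam : ℝ =>
        ENNReal.log (1 - CoxPerc.percProb P (X lam) lam r) / (lam : EReal)) atTop) ∧
    (2 ≤ d → (∃ b : ℝ≥0, CoxPerc.IsBDependent P Lam b) →
      (∀ δ : ℝ, 0 < δ → 0 < essInf (fun ω => Lam ω (CoxPerc.cube δ 0)) P) →
      ∃ L : ℝ≥0∞,
        Tendsto (fun ε : ℝ => CoxPerc.isolationCost P Lam (r + ε) (r - ε)) (𝓝[>] 0) (𝓝 L) ∧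
        limsup (fun lam : ℝ =>
          ENNReal.log (1 - CoxPerc.percProb P (X lam) lam r) / (lam : EReal)) atTop ≤
          -(L : EReal)) := by
  have hfin := hstat.ae_locFin hLam hint
  have hpalm := hstat.palm_univ hLam hint
  refine ⟨?_, fun hd _ hess => ?_⟩
  · by_contra! hlt
    obtain ⟨x, hx1, hx2⟩ := EReal.lt_iff_exists_real_btwn.mp hlt
    have hK : (CoxPerc.isolationCost P Lam r r : EReal) < ((-x : ℝ) : EReal) := by
      rw [EReal.coe_neg]; exact EReal.lt_neg_comm.mp hx2
    have hK0 : 0 < -x := by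
      have := (EReal.coe_ennreal_nonneg _).trans_lt hK
      exact_mod_cast this
    have hK' : CoxPerc.isolationCost P Lam r r < ENNReal.ofReal (-x) := by
      rwa [← EReal.coe_ennreal_lt_coe_ennreal_iff, EReal.coe_ennreal_ofReal,
        max_eq_left hK0.le]
    obtain ⟨A, hA⟩ := iInf_lt_iff.mp hK'
    obtain ⟨hAr, hA⟩ := iInf_lt_iff.mp hA
    set S := CoxPerc.rBoundary r A with hS
    have hSo : IsOpen S := CoxPerc.isOpen_rBoundary r hAr.1
    -- Since `-x` exceeds the essential infimum of the shell mass, `E` has positive Palm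
    -- probability; it is the prefactor in the exponential lower bound.
    set E : Set (Measure (CoxPerc.Space d)) := {μ | μ S < ENNReal.ofReal (-x)} with hE
    have hEm : MeasurableSet E :=
      measurableSet_lt (Measure.measurable_coe hSo.measurableSet) measurable_const
    have hE0 : CoxPerc.palm P Lam E ≠ 0 := by
      intro h0
      refine absurd hA (not_lt.mpr (le_essInf_of_ae_le _ ?_))
      filter_upwards [measure_eq_zero_iff_ae_notMem.mp h0] with μ hμ using not_lt.mp hμ
    have hE1 : CoxPerc.palm P Lam E ≠ ∞ :=
      ne_top_of_le_ne_top (by rw [hpalm]; exact ENNReal.one_ne_top)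
        (measure_mono (Set.subset_univ E))
    have hm : 0 < (CoxPerc.palm P Lam E).toReal := ENNReal.toReal_pos hE0 hE1
    have hle := CoxPerc.le_liminf_log_div (K := -x)
      (u := fun lam => 1 - CoxPerc.percProb P (X lam) lam r) hm (by
        filter_upwards [eventually_gt_atTop 0] with lam hlam
        refine le_trans ?_ (CoxPerc.lintegral_voidProb_le hLam hfin hpalm hlam (hX lam hlam)
          hAr.1 hAr.2.1)
        calc ENNReal.ofReal ((CoxPerc.palm P Lam E).toReal * Real.exp (-(lam * -x)))
            = ∫⁻ _ in E, CoxPerc.voidProb (ENNReal.ofReal lam * ENNReal.ofReal (-x))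
                ∂(CoxPerc.palm P Lam) := by
              rw [setLIntegral_const, ← ENNReal.ofReal_mul hlam.le,
                CoxPerc.voidProb_ofReal (by positivity), ENNReal.ofReal_mul hm.le,
                ENNReal.ofReal_toReal hE1, mul_comm]
          _ ≤ ∫⁻ μ in E, CoxPerc.voidProb (ENNReal.ofReal lam * μ S) ∂(CoxPerc.palm P Lam) := by
              refine setLIntegral_mono' hEm fun μ hμ => CoxPerc.voidProb_antitone ?_
              have hμ' : μ S ≤ ENNReal.ofReal (-x) := le_of_lt hμ
              gcongr
          _ ≤ _ := setLIntegral_le_lintegral _ _)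
    rw [neg_neg] at hle
    exact absurd hx1 (not_lt.mpr hle)
  · refine ⟨_, (CoxPerc.antitone_isolationCost P Lam r).tendsto_nhdsGT 0, ?_⟩
    by_contra! hlt
    obtain ⟨x, hx1, hx2⟩ := EReal.lt_iff_exists_real_btwn.mp hlt
    obtain ⟨ε, hε, hK⟩ : ∃ ε : ℝ, 0 < ε ∧
        ENNReal.ofReal (-x) ≤ CoxPerc.isolationCost P Lam (r + ε) (r - ε) := by
      rcases le_or_gt (-x) 0 with h | h
      · exact ⟨1, one_pos, by rw [ENNReal.ofReal_of_nonpos h]; exact zero_le⟩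
      · have hKL : ENNReal.ofReal (-x) < sSup ((fun ε : ℝ =>
            CoxPerc.isolationCost P Lam (r + ε) (r - ε)) '' Set.Ioi 0) := by
          rw [← EReal.coe_ennreal_lt_coe_ennreal_iff, EReal.coe_ennreal_ofReal,
            max_eq_left h.le, EReal.coe_neg]
          exact EReal.neg_lt_comm.mp hx1
        obtain ⟨_, ⟨ε, hε, rfl⟩, h2⟩ := lt_sSup_iff.mp hKL
        exact ⟨ε, hε, h2.le⟩
    -- A finite nonnegative rate below the cost at some `ε`; working with such `K` also covers an
    -- infinite limit.
    set K : ℝ := max (-x) 0 with hKdef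
    have hK0 : 0 ≤ K := le_max_right _ _
    have hK' : ENNReal.ofReal K ≤ CoxPerc.isolationCost P Lam (r + ε) (r - ε) := by
      rw [hKdef, ENNReal.ofReal_max, ENNReal.ofReal_zero, max_eq_left zero_le]
      exact hK
    obtain ⟨δ, hδ, hδε, hδr⟩ : ∃ δ : ℝ, 0 < δ ∧ √d * δ ≤ ε ∧ √d * (2 * δ) < r / 2 := by
      have hs : 0 ≤ √(d : ℝ) := Real.sqrt_nonneg _
      have hmin : 0 < min ε r := lt_min hε hr
      refine ⟨min ε r / (8 * (√d + 1)), by positivity, ?_, ?_⟩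
      · have : √d * (min ε r / (8 * (√d + 1))) ≤ min ε r := by
          rw [mul_div_assoc', div_le_iff₀ (by positivity)]
          nlinarith
        exact this.trans (min_le_left _ _)
      · have : √d * (2 * (min ε r / (8 * (√d + 1)))) ≤ min ε r / 4 := by
          rw [mul_div_assoc', mul_div_assoc', div_le_iff₀ (by positivity)]
          nlinarith
        linarith [min_le_right ε r]
    have hcpos := hess (δ / 2) (by positivity)
    obtain ⟨c, hc0, hc⟩ := ENNReal.lt_iff_exists_real_btwn.mp hcpos
    obtain ⟨hc1, hc2⟩ := hc
    have hc' : 0 < c := by simpa using hc1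
    have hcube : ∀ᵐ μ ∂(CoxPerc.palm P Lam), ∀ z : Fin d → ℤ,
        ENNReal.ofReal c ≤ μ (CoxPerc.openCube δ z) := by
      filter_upwards [hstat.ae_palm_openCube hLam hint hδ] with μ hμ z using hc2.le.trans (hμ z)
    -- The box is large enough for the path term, of rate `c * n`, to decay at least as fast as the
    -- isolation term.
    obtain ⟨n, hn⟩ := exists_nat_ge (K / c)
    have hn' : K ≤ c * n := by rw [div_le_iff₀ hc'] at hn; linarith
    obtain ⟨lam₀, C, hC, hsum⟩ := CoxPerc.tsum_paths_le d n hc'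
    set m : ℝ := ((CoxPerc.siteBox d (2 * n)).powerset.card : ℝ) with hm
    have hm0 : 0 ≤ m := Nat.cast_nonneg _
    have hle := CoxPerc.limsup_log_div_le (K := K) (C := m + C)
      (u := fun lam => 1 - CoxPerc.percProb P (X lam) lam r) (by positivity) (by
        filter_upwards [eventually_gt_atTop 0, eventually_ge_atTop lam₀] with lam hlam hlam'
        refine (CoxPerc.one_sub_percProb_le hd hLam hfin hpalm hlam (hX lam hlam) hc' hcube hr hε
          hδ hδε hδr n hK0 hK').trans ((add_le_add_right (hsum lam hlam') _).trans ?_)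
        rw [← ENNReal.ofReal_add (by positivity) (by positivity), add_mul]
        refine ENNReal.ofReal_le_ofReal (add_le_add_right ?_ _)
        gcongr)
    have hle' : ((-K : ℝ) : EReal) ≤ (x : EReal) := by
      have : -K ≤ x := by linarith [le_max_left (-x) 0]
      exact_mod_cast this
    exact absurd hx2 (not_lt.mpr (hle.trans hle'))
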